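/- Let $r>1$, let $2=p_1<p_2<\cdots<p_r$ be primes with $p_{t+1}\equiv 1 \pmod{p_t-1}$ for all $0<t<r-1$ and $p_r\ge (p_{r-1}-2)(p_{r-1}-3)$. Put $\alpha_t=\frac{p_{t+1}-1}{p_t-1}-1$ for $0<t<r-1$, $\alpha_{r-1}=\left\lfloor\frac{p_r-1}{p_{r-1}-1}\right\rfloor$ and $\alpha_r=1$, and let $L=p_1^{\alpha_1}\cdots p_{r-1}^{\alpha_{r-1}}p_r^{\alpha_r}$ (these $L$ are the members of Sun's family $\mathcal L$ of primitive covering numbers). A covering is a finite set of congruences $z\equiv x \pmod m$, written $(x,m)$ with $0\le x<m$, having distinct moduli $m\ge 2$, such that every integer satisfies at least one of them; it is minimal if no proper subset of it is a covering. For a finite set $M$ of positive integers let $\mathcal C_M$ be the set of coverings whose set of moduli is exactly $M$. The set $M$ is called minimal if $\mathcal C_M\neq\emptyset$ and every $C\in\mathcal C_M$ is minimal. Let $M$ be minimal with $\operatorname{lcm}(M)=L$, and let $C\in\mathcal C_M$. For $1\le s\le r$ and $1\le t\le\alpha_s$ let $C_{p_s^t}$ be the set of all $(x,m)\in C$ such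 that $p_s^t$ exactly divides $m$ and $p_k\nmid m$ for all $k>s$, and let $Q$ be the set of all $(x,m)\in C_{p_r}$ with $p_{r-1}^{\alpha_{r-1}}\nmid m$. Then $|C_{p_{r-1}^{\alpha_{r-1}}}|\le p_{r-1}$, $|Q|\le p_r$, and $$|\mathcal C_M| = \frac{\left(|C_{p_r}|-|Q|\right)!}{\left(p_{r-1}-|C_{p_{r-1}^{\alpha_{r-1}}}|\right)!\,\left(p_r-|Q|\right)!}\prod_{i=1}^{r}\left(p_i!\right)^{\alpha_i}.$$ -/

import Mathlib

open scoped Nat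

/-- A covering with distinct moduli. The pair `(x, m)` stands for the congruence
`z ≡ x (mod m)`; since a congruence only depends on `x` modulo `m`, it is represented by its
least nonnegative residue `x < m`. Moduli are at least `2`, no modulus occurs twice, and every
integer satisfies at least one of the congruences. -/
def IsCovering (C : Finset (ℕ × ℕ)) : Prop :=
  (∀ c ∈ C, 2 ≤ c.2 ∧ c.1 < c.2) ∧
  (∀ c ∈ C, ∀ d ∈ C, c.2 = d.2 → c = d) ∧
  ∀ z : ℤ, ∃ c ∈ C, z ≡ (c.1 : ℤ) [ZMOD (c.2 : ℤ)]

/-- A covering is minimal if no proper subset of it is a covering. -/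
def IsMinimalCovering (C : Finset (ℕ × ℕ)) : Prop :=
  IsCovering C ∧ ∀ B : Finset (ℕ × ℕ), B ⊂ C → ¬ IsCovering B

/-- The set of all coverings whose set of moduli is exactly `M`. -/
def coveringsWithModuli (M : Finset ℕ) : Set (Finset (ℕ × ℕ)) :=
  {C | IsCovering C ∧ C.image Prod.snd = M}

/-- A set of moduli is minimal if it is the set of moduli of some covering and all coverings
with this set of moduli are minimal. -/
def IsMinimalModuli (M : Finset ℕ) : Prop :=
  (coveringsWithModuli M).Nonempty ∧ ∀ C ∈ coveringsWithModuli M, IsMinimalCovering C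

/-- The primes `p 1 < ⋯ < p r` and exponents `α 1, …, α r` of a member
`p 1 ^ α 1 * ⋯ * p r ^ α r` of Sun's family of primitive covering numbers.
Only the values of `p` and `α` at `1, …, r` matter. -/
structure IsSunFactorization (r : ℕ) (p α : ℕ → ℕ) : Prop where
  one_lt : 1 < r
  prime : ∀ t, 1 ≤ t → t ≤ r → (p t).Prime
  first : p 1 = 2
  increasing : ∀ t, 1 ≤ t → t < r → p t < p (t + 1)
  modEq : ∀ t, 0 < t → t < r - 1 → p (t + 1) ≡ 1 [MOD p t - 1]
  last_ge : ((p (r - 1) : ℤ) - 2) * ((p (r - 1) : ℤ) - 3) ≤ (p r : ℤ)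
  exponent : ∀ t, 0 < t → t < r - 1 → α t = (p (t + 1) - 1) / (p t - 1) - 1
  /-- Division of natural numbers is the floor of the quotient. -/
  exponent_pred : α (r - 1) = (p r - 1) / (p (r - 1) - 1)
  exponent_last : α r = 1

/-- The congruences `(x, m)` in `C` such that `p s ^ t` exactly divides `m` and `p k ∤ m` for all
`s < k ≤ r`. -/
def levelPart (r : ℕ) (p : ℕ → ℕ) (C : Finset (ℕ × ℕ)) (s t : ℕ) : Finset (ℕ × ℕ) :=
  C.filter fun c => (p s ^ t ∣ c.2 ∧ ¬ p s ^ (t + 1) ∣ c.2) ∧ ∀ k ∈ Finset.Ioc s r, ¬ p k ∣ c.2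

/-- The congruences in the part of `C` at level `p r` whose modulus is not divisible by
`p (r - 1) ^ α (r - 1)`. -/
def partQ (r : ℕ) (p α : ℕ → ℕ) (C : Finset (ℕ × ℕ)) : Finset (ℕ × ℕ) :=
  (levelPart r p C r 1).filter fun c => ¬ p (r - 1) ^ α (r - 1) ∣ c.2

/-!
Order the prime powers `p s ^ t` lexicographically and write
`N s t = p 1 ^ α 1 ⋯ p (s - 1) ^ α (s - 1) * p s ^ t` (`chainModulus`). The congruences of a covering
are added in the order in which their moduli first divide some `N s t`. The conditions on the
exponents say that exactly `p s - 1` divisors of `N s (t + 1)` do not divide `N s t`, for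
`s ≤ r - 1`. Inside one class modulo `N s t` such a modulus meets at most one of the `p s` classes
modulo `N s (t + 1)`, so every class left uncovered (a hole) contains an uncovered class of the
next level.

The decisive point is that a covering has only one hole at each level before the last power of
`p (r - 1)` (`not_two_holes`). Two holes that differ modulo `p (r - 1) ^ t` would survive up to the
modulus `L / p r`, and the `2 * p r` classes modulo `L` above them have to be covered by the moduli
divisible by `p r`. Each of these covers at most two of the classes, and at most one if it is
divisible by `p (r - 1) ^ t`, which leads to
`2 * p r ≤ (p (r - 1) - 1) * (α (r - 1) + 1 + t)` (`two_mul_last_le`). This is false for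
`1 ≤ t < α (r - 1)`, and also for `t = 1` when `r > 2`; the latter is where the lower bound for
`p r` is used. Two holes that already differ before the first power of `p (r - 1)` are reduced to the case
`t = 1`, because one level with at most `p (r - 1) - 1` moduli cannot cover all translates of both
outside a single residue class modulo `p (r - 1)` (`modEq_of_uncovered`).

In a minimal covering every modulus has a private point, so no modulus is wasted (`IsTight`), and
the single hole forces exactly `p s - 1` moduli at each of these levels, placed on different classes:
this gives `(p s)!` choices (`ncard_singleHoleSystems_mul`). What remains is one class modulo
`N = N (r - 1) (α (r - 1) - 1)`, viewed as a `p (r - 1) × p r` grid of classes modulo `L`. The moduli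
at the level of `p (r - 1) ^ α (r - 1)` take distinct rows, those in `Q` distinct columns, and the
other multiples of `p r` fill the remaining cells bijectively (`ncard_coveringSystems_grid`). The
number of remaining cells depends only on the set of moduli, so conversely every such placement is
a covering.
-/

/-! ### Residue systems, holes and tight stages -/

/-- The systems of residues on the set of moduli `S`: functions choosing a least nonnegative
residue for every `m ∈ S`, and extended by `0` outside `S`. -/
def residueSystems (S : Finset ℕ) : Set (ℕ → ℕ) :=
  {f | (∀ m ∈ S, f m < m) ∧ ∀ m ∉ S, f m = 0}

/-- The integers that satisfy none of the congruences `z ≡ f m (mod m)`, `m ∈ S`. -/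
def uncovered (S : Finset ℕ) (f : ℕ → ℕ) : Set ℤ :=
  {z | ∀ m ∈ S, ¬ z ≡ (f m : ℤ) [ZMOD (m : ℤ)]}

/-- The residue classes modulo `D` that meet `H`. -/
def classesMod (H : Set ℤ) (D : ℕ) : Set (ZMod D) := (fun z : ℤ => (z : ZMod D)) '' H

/-- Every modulus `m ∈ T` has a private point: an integer that is not covered by the moduli in `S`
and that `m` is the only modulus in `T` to cover. -/
def IsTight (S T : Finset ℕ) (f : ℕ → ℕ) : Prop :=
  ∀ m ∈ T, ∃ z ∈ uncovered S f, z ≡ (f m : ℤ) [ZMOD (m : ℤ)] ∧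
    ∀ m' ∈ T, z ≡ (f m' : ℤ) [ZMOD (m' : ℤ)] → m' = m

/-- Within `H`, being congruent modulo some `m ∈ T` is the same as being congruent modulo `D`, so
that a congruence with modulus in `T` covers at most one of the classes modulo `D` that
meet `H`. -/
def Separates (T : Finset ℕ) (H : Set ℤ) (D : ℕ) : Prop :=
  ∀ m ∈ T, m ∣ D ∧ ∀ z ∈ H, ∀ w ∈ H, z ≡ w [ZMOD (m : ℤ)] → z ≡ w [ZMOD (D : ℤ)]

/-- The integers left uncovered form exactly one residue class modulo `N`. -/
def HasSingleHole (S : Finset ℕ) (f : ℕ → ℕ) (N : ℕ) : Prop :=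
  ∃ h : ℤ, ∀ z : ℤ, z ∈ uncovered S f ↔ z ≡ h [ZMOD (N : ℤ)]

/-- The moduli in `M` that divide `N`. -/
def modsDividing (M : Finset ℕ) (N : ℕ) : Finset ℕ := M.filter (· ∣ N)

/-- The moduli in `M` that divide `N * b` but not `N`. -/
def newMods (M : Finset ℕ) (N b : ℕ) : Finset ℕ := M.filter fun m => m ∣ N * b ∧ ¬ m ∣ N

/-- The restriction of a residue system to `S`. -/
noncomputable def restrictTo (S : Finset ℕ) (f : ℕ → ℕ) : ℕ → ℕ := (S : Set ℕ).indicator f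

theorem restrictTo_apply_mem {S : Finset ℕ} {f : ℕ → ℕ} {m : ℕ} (h : m ∈ S) :
    restrictTo S f m = f m := Set.indicator_of_mem (by exact_mod_cast h) f

theorem restrictTo_apply_notMem {S : Finset ℕ} {f : ℕ → ℕ} {m : ℕ} (h : m ∉ S) :
    restrictTo S f m = 0 := Set.indicator_of_notMem (by exact_mod_cast h) f

theorem uncovered_congr {S : Finset ℕ} {f g : ℕ → ℕ} (h : ∀ m ∈ S, f m = g m) :
    uncovered S f = uncovered S g := by
  ext z
  simp only [uncovered, Set.mem_ofPred_eq]
  exact forall₂_congr fun m hm => by rw [h m hm]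

theorem uncovered_restrictTo (S : Finset ℕ) (f : ℕ → ℕ) :
    uncovered S (restrictTo S f) = uncovered S f :=
  uncovered_congr fun _ hm => restrictTo_apply_mem hm

theorem mem_uncovered_union {S T : Finset ℕ} {f : ℕ → ℕ} {z : ℤ} :
    z ∈ uncovered (S ∪ T) f ↔
      z ∈ uncovered S f ∧ ∀ m ∈ T, ¬ z ≡ (f m : ℤ) [ZMOD (m : ℤ)] := by
  simp only [uncovered, Set.mem_ofPred_eq, Finset.mem_union, or_imp, forall_and]

theorem uncovered_mono {S T : Finset ℕ} (h : S ⊆ T) (f : ℕ → ℕ) :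
    uncovered T f ⊆ uncovered S f := fun _ hz m hm => hz m (h hm)

theorem uncovered_periodic {S : Finset ℕ} {f : ℕ → ℕ} {D : ℕ} (hS : ∀ m ∈ S, m ∣ D) {z w : ℤ}
    (hzw : z ≡ w [ZMOD (D : ℤ)]) (hw : w ∈ uncovered S f) : z ∈ uncovered S f := by
  intro m hm hz
  exact hw m hm ((hzw.of_dvd (by exact_mod_cast hS m hm)).symm.trans hz)

theorem mem_modsDividing {M : Finset ℕ} {N m : ℕ} : m ∈ modsDividing M N ↔ m ∈ M ∧ m ∣ N :=
  Finset.mem_filter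

theorem mem_newMods {M : Finset ℕ} {N b m : ℕ} :
    m ∈ newMods M N b ↔ m ∈ M ∧ m ∣ N * b ∧ ¬ m ∣ N := Finset.mem_filter

theorem modsDividing_union_newMods (M : Finset ℕ) (N b : ℕ) :
    modsDividing M N ∪ newMods M N b = modsDividing M (N * b) := by
  ext m
  simp only [Finset.mem_union, mem_modsDividing, mem_newMods]
  have : m ∣ N → m ∣ N * b := fun h => h.mul_right b
  tauto

theorem disjoint_modsDividing_newMods (M : Finset ℕ) (N b : ℕ) :
    Disjoint (modsDividing M N) (newMods M N b) := by
  rw [Finset.disjoint_left]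
  intro m hm hm'
  exact (mem_newMods.1 hm').2.2 (mem_modsDividing.1 hm).2

theorem isTight_congr {S T : Finset ℕ} {f g : ℕ → ℕ} (h : ∀ m ∈ S ∪ T, f m = g m) :
    IsTight S T f ↔ IsTight S T g := by
  have hT : ∀ m ∈ T, f m = g m := fun m hm => h m (Finset.mem_union_right _ hm)
  unfold IsTight
  rw [uncovered_congr fun m hm => h m (Finset.mem_union_left _ hm)]
  refine forall₂_congr fun m hm => exists_congr fun z => and_congr_right fun _ => ?_
  rw [hT m hm]
  refine and_congr_right fun _ => forall₂_congr fun m' hm' => ?_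
  rw [hT m' hm']

/-- If every modulus in `S ∪ T` has a point that no other modulus in `S ∪ T` covers, then `T` is
tight over `S`. -/
theorem isTight_of_private {M S T : Finset ℕ} {f : ℕ → ℕ} (hS : S ⊆ M) (hT : T ⊆ M)
    (hd : Disjoint S T)
    (hf : ∀ m ∈ M, ∃ z : ℤ, z ≡ (f m : ℤ) [ZMOD (m : ℤ)] ∧
      ∀ m' ∈ M, z ≡ (f m' : ℤ) [ZMOD (m' : ℤ)] → m' = m) : IsTight S T f := by
  intro m hm
  obtain ⟨z, hz, hz'⟩ := hf m (hT hm)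
  refine ⟨z, fun m' hm' h => ?_, hz, fun m' hm' => hz' m' (hT hm')⟩
  have := hz' m' (hS hm') h
  subst this
  exact Finset.disjoint_left.1 hd hm' hm

theorem restrictTo_mem {S T : Finset ℕ} {f : ℕ → ℕ} (hf : f ∈ residueSystems T) (h : S ⊆ T) :
    restrictTo S f ∈ residueSystems S := by
  refine ⟨fun m hm => ?_, fun m hm => restrictTo_apply_notMem hm⟩
  rw [restrictTo_apply_mem hm]
  exact hf.1 m (h hm)

theorem residueSystems_finite (S : Finset ℕ) : (residueSystems S).Finite := by
  classical
  refine Set.Finite.of_injOn (f := fun f : ℕ → ℕ => fun m : S => f m)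
    (t := Set.pi Set.univ fun m : S => Set.Iio (m : ℕ)) ?_ ?_
    (Set.Finite.pi fun m => Set.finite_Iio _)
  · intro f hf m _
    exact hf.1 m m.2
  · intro f hf g hg h
    funext m
    by_cases hm : m ∈ S
    · exact congrFun h ⟨m, hm⟩
    · rw [hf.2 m hm, hg.2 m hm]

theorem zmod_eq_iff {D : ℕ} {z w : ℤ} : (z : ZMod D) = (w : ZMod D) ↔ z ≡ w [ZMOD (D : ℤ)] :=
  ZMod.intCast_eq_intCast_iff z w D

/-- A tight stage removes exactly one class modulo `D` for every modulus. -/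
theorem ncard_classesMod_add_card {S T : Finset ℕ} {f : ℕ → ℕ} {D : ℕ} [NeZero D]
    (hsep : Separates T (uncovered S f) D) (ht : IsTight S T f) :
    (classesMod (uncovered (S ∪ T) f) D).ncard + T.card = (classesMod (uncovered S f) D).ncard := by
  classical
  choose! z hzU hz hz' using ht
  have hinj : Set.InjOn (fun m => ((z m : ℤ) : ZMod D)) (T : Set ℕ) := by
    intro m hm m' hm' h
    have h1 : z m ≡ z m' [ZMOD (D : ℤ)] := zmod_eq_iff.1 h
    have h2 := (h1.of_dvd (by exact_mod_cast (hsep m' hm').1)).trans (hz m' hm')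
    exact (hz' m hm m' hm' h2).symm
  have hsplit : classesMod (uncovered S f) D =
      classesMod (uncovered (S ∪ T) f) D ∪ (fun m => ((z m : ℤ) : ZMod D)) '' (T : Set ℕ) := by
    ext c
    constructor
    · rintro ⟨u, hu, rfl⟩
      by_cases h : ∃ m ∈ T, u ≡ (f m : ℤ) [ZMOD (m : ℤ)]
      · obtain ⟨m, hm, hum⟩ := h
        refine Or.inr ⟨m, hm, ?_⟩
        exact zmod_eq_iff.2 ((hsep m hm).2 _ (hzU m hm) _ hu ((hz m hm).trans hum.symm))
      · exact Or.inl ⟨u, mem_uncovered_union.2 ⟨hu, by simpa using h⟩, rfl⟩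
    · rintro (⟨u, hu, rfl⟩ | ⟨m, hm, rfl⟩)
      · exact ⟨u, (mem_uncovered_union.1 hu).1, rfl⟩
      · exact ⟨z m, hzU m hm, rfl⟩
  have hdisj : Disjoint (classesMod (uncovered (S ∪ T) f) D)
      ((fun m => ((z m : ℤ) : ZMod D)) '' (T : Set ℕ)) := by
    rw [Set.disjoint_left]
    rintro _ ⟨u, hu, rfl⟩ ⟨m, hm, h⟩
    have h1 : z m ≡ u [ZMOD (D : ℤ)] := zmod_eq_iff.1 h
    have h2 := (h1.of_dvd (by exact_mod_cast (hsep m hm).1)).symm.trans (hz m hm)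
    exact (mem_uncovered_union.1 hu).2 m hm h2
  rw [hsplit, Set.ncard_union_eq hdisj, hinj.ncard_image, Set.ncard_coe_finset]

/-- The number of tight extensions of a residue system: they correspond to the injections of `T`
into the classes modulo `D` that are not yet covered. -/
theorem ncard_tight_extensions {S T : Finset ℕ} {f₀ : ℕ → ℕ} {D : ℕ} [NeZero D]
    (hd : Disjoint S T) (hf₀ : f₀ ∈ residueSystems S) (hsep : Separates T (uncovered S f₀) D) :
    {f | f ∈ residueSystems (S ∪ T) ∧ IsTight S T f ∧ restrictTo S f = f₀}.ncard =
      (classesMod (uncovered S f₀) D).ncard.descFactorial T.card := by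
  classical
  set A := classesMod (uncovered S f₀) D with hA
  have hT0 : ∀ m ∈ T, 0 < m := fun m hm => Nat.pos_of_dvd_of_pos (hsep m hm).1 (NeZero.pos D)
  let ext : (T ↪ A) → ℕ → ℕ := fun e m => if h : m ∈ T then (e ⟨m, h⟩ : ZMod D).val % m else f₀ m
  have hext : ∀ e (m : ℕ) (h : m ∈ T), ∀ u : ℤ, (u : ZMod D) = (e ⟨m, h⟩ : ZMod D) →
      u ≡ (ext e m : ℤ) [ZMOD (m : ℤ)] := by
    intro e m h u hu
    have h1 : u ≡ ((e ⟨m, h⟩ : ZMod D).val : ℤ) [ZMOD (D : ℤ)] := by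
      rw [← zmod_eq_iff, hu]; simp
    have h2 := h1.of_dvd (m := (m : ℤ)) (by exact_mod_cast (hsep m h).1)
    simp only [ext, h, dif_pos]
    rw [Int.natCast_mod]
    exact h2.trans (Int.mod_modEq _ _).symm
  have hres : ∀ e, restrictTo S (ext e) = f₀ := by
    intro e
    funext m
    by_cases hm : m ∈ S
    · rw [restrictTo_apply_mem hm]
      simp [ext, Finset.disjoint_left.1 hd hm]
    · rw [restrictTo_apply_notMem hm, hf₀.2 m hm]
  have hunc : ∀ e, uncovered S (ext e) = uncovered S f₀ := fun e => by
    rw [← uncovered_restrictTo, hres]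
  have hinj : Function.Injective ext := by
    intro e e' h
    ext ⟨m, hm⟩
    obtain ⟨u, hu, hue⟩ := (e ⟨m, hm⟩).2
    obtain ⟨u', hu', hue'⟩ := (e' ⟨m, hm⟩).2
    have h1 := hext e m hm u hue
    have h2 := hext e' m hm u' hue'
    rw [← h] at h2
    rw [← hue, ← hue']
    exact zmod_eq_iff.2 ((hsep m hm).2 u hu u' hu' (h1.trans h2.symm))
  have hrange : {f | f ∈ residueSystems (S ∪ T) ∧ IsTight S T f ∧ restrictTo S f = f₀} =
      ext '' Set.univ := by
    ext f
    constructor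
    · rintro ⟨hf, ht, hr⟩
      have hU : uncovered S f = uncovered S f₀ := by rw [← uncovered_restrictTo, hr]
      unfold IsTight at ht
      rw [hU] at ht
      choose! z hzU hz hz' using ht
      have hinj' : Function.Injective
          (fun m : T => (⟨(z m : ZMod D), z m, hzU m m.2, rfl⟩ : A)) := by
        intro m m' h
        have h1 : z m ≡ z m' [ZMOD (D : ℤ)] := zmod_eq_iff.1 (congrArg Subtype.val h)
        have h2 := (h1.of_dvd (by exact_mod_cast (hsep m' m'.2).1)).trans (hz m' m'.2)
        exact Subtype.ext (hz' m m.2 m' m'.2 h2).symm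
      refine ⟨⟨_, hinj'⟩, trivial, ?_⟩
      · funext m
        by_cases hm : m ∈ T
        · have h1 := (hext ⟨_, hinj'⟩ m hm (z m) rfl).symm.trans (hz m hm)
          have h2 : ext _ m ≡ f m [MOD m] := Int.natCast_modEq_iff.1 h1
          refine Nat.ModEq.eq_of_lt_of_lt h2 ?_ (hf.1 m (Finset.mem_union_right _ hm))
          simp only [ext, hm, dif_pos]
          exact Nat.mod_lt _ (hT0 m hm)
        · simp only [ext, hm, dif_neg, not_false_eq_true]
          by_cases hS : m ∈ S
          · rw [← hr, restrictTo_apply_mem hS]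
          · rw [hf₀.2 m hS, hf.2 m (by simp [hm, hS])]
    · rintro ⟨e, -, rfl⟩
      refine ⟨⟨fun m hm => ?_, fun m hm => ?_⟩, fun m hm => ?_, hres e⟩
      · by_cases h : m ∈ T
        · simp only [ext, h, dif_pos]
          exact Nat.mod_lt _ (hT0 m h)
        · simp only [ext, h, dif_neg, not_false_eq_true]
          exact hf₀.1 m (by simpa [h] using hm)
      · simp only [Finset.mem_union, not_or] at hm
        simp only [ext, hm.2, dif_neg, not_false_eq_true]
        exact hf₀.2 m hm.1
      · obtain ⟨u, hu, hue⟩ := (e ⟨m, hm⟩).2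
        refine ⟨u, (hunc e).symm ▸ hu, hext e m hm u hue, fun m' hm' h => ?_⟩
        obtain ⟨u', hu', hue'⟩ := (e ⟨m', hm'⟩).2
        have h1 := (hsep m' hm').2 u hu u' hu' (h.trans (hext e m' hm' u' hue').symm)
        have h2 : e ⟨m', hm'⟩ = e ⟨m, hm⟩ := Subtype.ext (by
          rw [← hue, ← hue']; exact (zmod_eq_iff.2 h1).symm)
        exact congrArg Subtype.val (e.injective h2)
  have : Fintype A := Fintype.ofFinite A
  rw [hrange, Set.ncard_image_of_injective _ hinj, Set.ncard_univ, Nat.card_eq_fintype_card,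
    Fintype.card_embedding_eq, Fintype.card_coe, ← Nat.card_eq_fintype_card, Nat.card_coe_set_eq]

theorem ncard_eq_mul_of_fibers {β γ : Type*} {X : Set β} {Y : Set γ} (hX : X.Finite)
    (hY : Y.Finite) (res : β → γ) (hres : Set.MapsTo res X Y) (k : ℕ)
    (hk : ∀ y ∈ Y, {x | x ∈ X ∧ res x = y}.ncard = k) : X.ncard = Y.ncard * k := by
  classical
  have := Finset.card_eq_sum_card_fiberwise (f := res) (s := hX.toFinset) (t := hY.toFinset)
    (by simpa using hres)
  rw [Set.ncard_eq_toFinset_card X hX, Set.ncard_eq_toFinset_card Y hY, this,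
    Finset.sum_const_nat (m := k)]
  intro y hy
  rw [← hk y (by simpa using hy), ← Set.ncard_coe_finset]
  congr 1
  ext x
  simp

/-- Counting one stage: the tight extensions to `S ∪ T` of the residue systems in `X`. -/
theorem ncard_tight_stage {S T : Finset ℕ} {X : Set (ℕ → ℕ)} (hX : X ⊆ residueSystems S)
    (D c : ℕ) [NeZero D] (hd : Disjoint S T)
    (hsep : ∀ f ∈ X, Separates T (uncovered S f) D)
    (hc : ∀ f ∈ X, (classesMod (uncovered S f) D).ncard = c) :
    {f | f ∈ residueSystems (S ∪ T) ∧ IsTight S T f ∧ restrictTo S f ∈ X}.ncard =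
      X.ncard * c.descFactorial T.card := by
  refine ncard_eq_mul_of_fibers ((residueSystems_finite (S ∪ T)).subset fun f hf => hf.1)
    ((residueSystems_finite S).subset hX) (restrictTo S) (fun f hf => hf.2.2) _ fun f hf => ?_
  rw [← hc f hf, ← ncard_tight_extensions hd (hX hf) (hsep f hf)]
  congr 1
  ext g
  simp only [Set.mem_ofPred_eq]
  constructor
  · rintro ⟨⟨h1, h2, -⟩, h4⟩
    exact ⟨h1, h2, h4⟩
  · rintro ⟨h1, h2, h4⟩
    exact ⟨⟨h1, h2, h4 ▸ hf⟩, h4⟩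

/-! ### One prime level -/

theorem modEq_mul_of_newMod {N b m : ℕ} (hb : b.Prime) (hm : m ∣ N * b) (hmN : ¬ m ∣ N)
    {z w : ℤ} (hN : z ≡ w [ZMOD (N : ℤ)]) (h : z ≡ w [ZMOD (m : ℤ)]) :
    z ≡ w [ZMOD ((N * b : ℕ) : ℤ)] := by
  obtain ⟨k, hk⟩ := Nat.dvd_lcm_left N m
  have hN0 : N ≠ 0 := by rintro rfl; simp at hmN
  have hkb : k ∣ b := by
    have : N * k ∣ N * b := hk ▸ Nat.lcm_dvd (dvd_mul_right N b) hm
    exact Nat.dvd_of_mul_dvd_mul_left (Nat.pos_of_ne_zero hN0) this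
  have hlcm : Nat.lcm N m = N * b := by
    rcases (Nat.dvd_prime hb).1 hkb with rfl | rfl
    · exact absurd (by simpa [hk] using Nat.dvd_lcm_right N m) hmN
    · exact hk
  rw [Int.modEq_iff_dvd] at *
  rw [← hlcm]
  rw [Int.natCast_dvd] at *
  exact Nat.lcm_dvd hN h

theorem separates_newMods {M : Finset ℕ} {N b : ℕ} (hb : b.Prime) {H : Set ℤ}
    (hH : ∀ z ∈ H, ∀ w ∈ H, z ≡ w [ZMOD (N : ℤ)]) : Separates (newMods M N b) H (N * b) := by
  intro m hm
  obtain ⟨-, h1, h2⟩ := mem_newMods.1 hm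
  exact ⟨h1, fun z hz w hw h => modEq_mul_of_newMod hb h1 h2 (hH z hz w hw) h⟩

theorem add_mul_modEq (x : ℤ) (N : ℕ) (j : ℤ) : x + N * j ≡ x [ZMOD (N : ℤ)] := by
  simp [Int.ModEq]

/-- Distinct covered translates `x + N * j`, `j < b`, of an integer not covered by the moduli
dividing `N` are covered by distinct moduli. -/
theorem exists_covering_subset {M : Finset ℕ} {f : ℕ → ℕ} {N b : ℕ} (hb : b.Prime) (hN : 0 < N)
    {x : ℤ} (hx : x ∈ uncovered (modsDividing M N) f) {J : Finset ℕ} (hJ : J ⊆ Finset.range b)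
    (hcov : ∀ j ∈ J, x + N * (j : ℤ) ∉ uncovered (modsDividing M (N * b)) f) :
    ∃ A ⊆ newMods M N b, A.card = J.card ∧
      ∀ m ∈ A, ∃ j : ℕ, x + N * (j : ℤ) ≡ (f m : ℤ) [ZMOD (m : ℤ)] := by
  classical
  have h1 : ∀ j ∈ J, ∃ m ∈ newMods M N b, x + N * (j : ℤ) ≡ (f m : ℤ) [ZMOD (m : ℤ)] := by
    intro j hj
    have := hcov j hj
    rw [← modsDividing_union_newMods, mem_uncovered_union] at this
    simp only [not_and, not_forall, not_not] at this
    obtain ⟨m, hm, h⟩ := this (uncovered_periodic (fun m hm => (mem_modsDividing.1 hm).2)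
      (add_mul_modEq x N j) hx)
    exact ⟨m, hm, h⟩
  choose! a ha ha' using h1
  refine ⟨J.image a, ?_, Finset.card_image_of_injOn ?_, ?_⟩
  · intro m hm
    obtain ⟨j, hj, rfl⟩ := Finset.mem_image.1 hm
    exact ha j hj
  · intro j hj j' hj' h
    have h2 := ha' j' hj'
    rw [← show a j = a j' from h] at h2
    have h3 := (ha' j hj).trans h2.symm
    obtain ⟨-, h4, h5⟩ := mem_newMods.1 (ha j hj)
    have h6 := modEq_mul_of_newMod hb h4 h5
      ((add_mul_modEq x N j).trans (add_mul_modEq x N j').symm) h3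
    have h7 : (N : ℤ) * j ≡ N * j' [ZMOD (N : ℤ) * b] := by
      have := Int.ModEq.add_left_cancel' x h6
      exact_mod_cast this
    have h8 : (j : ℤ) ≡ j' [ZMOD (b : ℤ)] :=
      Int.ModEq.mul_left_cancel' (by exact_mod_cast hN.ne') h7
    exact Nat.ModEq.eq_of_lt_of_lt (Int.natCast_modEq_iff.1 h8) (Finset.mem_range.1 (hJ hj))
      (Finset.mem_range.1 (hJ hj'))
  · intro m hm
    obtain ⟨j, hj, rfl⟩ := Finset.mem_image.1 hm
    exact ⟨j, ha' j hj⟩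

/-- A hole always survives a level with fewer than `b` moduli. -/
theorem exists_uncovered_extension {M : Finset ℕ} {f : ℕ → ℕ} {N b : ℕ} (hb : b.Prime)
    (hN : 0 < N) (hcard : (newMods M N b).card < b) {x : ℤ}
    (hx : x ∈ uncovered (modsDividing M N) f) :
    ∃ x' : ℤ, x' ≡ x [ZMOD (N : ℤ)] ∧ x' ∈ uncovered (modsDividing M (N * b)) f := by
  by_contra! hcon
  obtain ⟨A, hA, hAc, -⟩ := exists_covering_subset hb hN hx (Finset.Subset.refl (Finset.range b))
    (fun j _ => hcon _ (add_mul_modEq x N j))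
  have := Finset.card_le_card hA
  rw [hAc, Finset.card_range] at this
  omega

/-- A modulus that covers a translate of `x` and a translate of `y` is counted twice, which limits
the number of translates of two holes that can be covered together. -/
theorem card_add_card_le {M : Finset ℕ} {f : ℕ → ℕ} {N b : ℕ} (hb : b.Prime) (hN : 0 < N)
    {x y : ℤ} (hx : x ∈ uncovered (modsDividing M N) f) (hy : y ∈ uncovered (modsDividing M N) f)
    {I J : Finset ℕ} (hI : I ⊆ Finset.range b) (hJ : J ⊆ Finset.range b)
    (hIcov : ∀ j ∈ I, x + N * (j : ℤ) ∉ uncovered (modsDividing M (N * b)) f)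
    (hJcov : ∀ j ∈ J, y + N * (j : ℤ) ∉ uncovered (modsDividing M (N * b)) f)
    {T : Finset ℕ} (hT : ∀ m ∈ newMods M N b, ∀ i j : ℕ,
      x + N * (i : ℤ) ≡ y + N * (j : ℤ) [ZMOD (m : ℤ)] → m ∈ T) :
    I.card + J.card ≤ (newMods M N b).card + T.card := by
  classical
  obtain ⟨A, hA, hAc, hA'⟩ := exists_covering_subset hb hN hx hI hIcov
  obtain ⟨B, hB, hBc, hB'⟩ := exists_covering_subset hb hN hy hJ hJcov
  rw [← hAc, ← hBc, ← Finset.card_union_add_card_inter]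
  refine add_le_add (Finset.card_le_card (Finset.union_subset hA hB)) (Finset.card_le_card ?_)
  intro m hm
  obtain ⟨h1, h2⟩ := Finset.mem_inter.1 hm
  obtain ⟨i, hi⟩ := hA' m h1
  obtain ⟨j, hj⟩ := hB' m h2
  exact hT m (hA h1) i j (hi.trans hj.symm)

theorem ncard_classesMod_of_hole {H : Set ℤ} {h : ℤ} {N b : ℕ} (hN : 0 < N) [NeZero (N * b)]
    (hH : ∀ z, z ∈ H ↔ z ≡ h [ZMOD (N : ℤ)]) : (classesMod H (N * b)).ncard = b := by
  have hb : 0 < b := Nat.pos_of_ne_zero (right_ne_zero_of_mul (NeZero.ne (N * b)))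
  have : classesMod H (N * b) =
      (fun j : ℕ => ((h + N * (j : ℤ) : ℤ) : ZMod (N * b))) '' (Finset.range b : Set ℕ) := by
    ext c
    constructor
    · rintro ⟨z, hz, rfl⟩
      obtain ⟨k, hk⟩ := ((hH z).1 hz).symm.dvd
      have hr : 0 ≤ k % b := Int.emod_nonneg _ (by exact_mod_cast hb.ne')
      have hlt : k % b < b := Int.emod_lt_of_pos _ (by exact_mod_cast hb)
      refine ⟨(k % b).toNat, by simp; omega, zmod_eq_iff.2 ?_⟩
      rw [Int.toNat_of_nonneg hr]
      have hz : z = h + N * k := by linarith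
      rw [hz, Nat.cast_mul]
      exact Int.ModEq.add_left _ (Int.ModEq.mul_left' (Int.mod_modEq _ _))
    · rintro ⟨j, -, rfl⟩
      exact ⟨_, (hH _).2 (add_mul_modEq h N j), rfl⟩
  rw [this, Set.InjOn.ncard_image, Set.ncard_coe_finset, Finset.card_range]
  intro j hj j' hj' h1
  have h2 := Int.ModEq.add_left_cancel' h (zmod_eq_iff.1 h1)
  rw [Nat.cast_mul] at h2
  have h8 : (j : ℤ) ≡ j' [ZMOD (b : ℤ)] :=
    Int.ModEq.mul_left_cancel' (by exact_mod_cast hN.ne') h2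
  exact Nat.ModEq.eq_of_lt_of_lt (Int.natCast_modEq_iff.1 h8) (by simpa using hj)
      (by simpa using hj')

theorem hasSingleHole_iff {S : Finset ℕ} {f : ℕ → ℕ} {N : ℕ} (hS : ∀ m ∈ S, m ∣ N) :
    HasSingleHole S f N ↔ (classesMod (uncovered S f) N).ncard = 1 := by
  rw [Set.ncard_eq_one]
  constructor
  · rintro ⟨h, hh⟩
    refine ⟨(h : ZMod N), ?_⟩
    ext c
    constructor
    · rintro ⟨z, hz, rfl⟩
      exact zmod_eq_iff.2 ((hh z).1 hz)
    · rintro rfl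
      exact ⟨h, (hh h).2 rfl, rfl⟩
  · rintro ⟨c, hc⟩
    obtain ⟨h, hh, rfl⟩ : c ∈ classesMod (uncovered S f) N := hc ▸ rfl
    refine ⟨h, fun z => ⟨fun hz => ?_, fun hz => uncovered_periodic hS hz hh⟩⟩
    have : (z : ZMod N) ∈ classesMod (uncovered S f) N := ⟨z, hz, rfl⟩
    rw [hc] at this
    exact zmod_eq_iff.1 this

/-- The residue systems on the moduli in `M` dividing `N` that leave one class modulo `N`. -/
def singleHoleSystems (M : Finset ℕ) (N : ℕ) : Set (ℕ → ℕ) :=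
  {f | f ∈ residueSystems (modsDividing M N) ∧ HasSingleHole (modsDividing M N) f N}

theorem HasSingleHole.restrictTo {S : Finset ℕ} {f : ℕ → ℕ} {N : ℕ} (h : HasSingleHole S f N) :
    HasSingleHole S (restrictTo S f) N := by
  unfold HasSingleHole
  rwa [uncovered_restrictTo]

/-- When a level has exactly `b - 1` moduli, the systems with a single hole after this level are
the tight extensions of those with a single hole before it. -/
theorem singleHoleSystems_mul {M : Finset ℕ} {N b : ℕ} (hb : b.Prime) (hN : 0 < N)
    (hcard : (newMods M N b).card + 1 = b) :
    singleHoleSystems M (N * b) =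
      {f | f ∈ residueSystems (modsDividing M N ∪ newMods M N b) ∧
        IsTight (modsDividing M N) (newMods M N b) f ∧
        restrictTo (modsDividing M N) f ∈ singleHoleSystems M N} := by
  classical
  have : NeZero (N * b) := ⟨(Nat.mul_pos hN hb.pos).ne'⟩
  ext f
  constructor
  · rintro ⟨hf, h, hh⟩
    rw [← modsDividing_union_newMods] at hf
    have hU : uncovered (modsDividing M (N * b)) f ⊆ uncovered (modsDividing M N) f := by
      rw [← modsDividing_union_newMods]
      exact uncovered_mono Finset.subset_union_left f
    have hsingle : ∀ z, z ∈ uncovered (modsDividing M N) f ↔ z ≡ h [ZMOD (N : ℤ)] := by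
      intro z
      constructor
      · intro hz
        obtain ⟨z', h1, h2⟩ := exists_uncovered_extension hb hN (by omega) hz
        have h3 := ((hh z').1 h2).of_dvd (m := (N : ℤ)) (by push_cast; exact dvd_mul_right _ _)
        exact h1.symm.trans h3
      · intro hz
        exact uncovered_periodic (fun m hm => (mem_modsDividing.1 hm).2) hz
          (hU ((hh h).2 rfl))
    refine ⟨hf, ?_, restrictTo_mem hf Finset.subset_union_left,
      HasSingleHole.restrictTo ⟨h, hsingle⟩⟩
    -- The `b - 1` translates of `h` other than `h` itself are covered by distinct new moduli, so
    -- every new modulus covers exactly one of them.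
    have hcov : ∀ j ∈ Finset.Ico 1 b, ∃ m ∈ newMods M N b,
        h + N * (j : ℤ) ≡ (f m : ℤ) [ZMOD (m : ℤ)] := by
      intro j hj
      by_contra! hcon
      have h1 : h + N * (j : ℤ) ∈ uncovered (modsDividing M (N * b)) f := by
        rw [← modsDividing_union_newMods, mem_uncovered_union]
        exact ⟨(hsingle _).2 (add_mul_modEq h N j), hcon⟩
      have h2 := ((hh _).1 h1).symm.dvd
      rw [add_sub_cancel_left, Nat.cast_mul] at h2
      have h3 : b ∣ j := by
        have := Int.dvd_of_mul_dvd_mul_left (a := (N : ℤ)) (by exact_mod_cast hN.ne') h2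
        exact_mod_cast this
      have := Nat.le_of_dvd (by simp at hj; omega) h3
      simp at hj
      omega
    choose! a ha ha' using hcov
    have key : ∀ m ∈ newMods M N b, ∀ i j : ℕ, h + N * (i : ℤ) ≡ (f m : ℤ) [ZMOD (m : ℤ)] →
        h + N * (j : ℤ) ≡ (f m : ℤ) [ZMOD (m : ℤ)] → i ≡ j [MOD b] := by
      intro m hm i j hi hj
      obtain ⟨-, h4, h5⟩ := mem_newMods.1 hm
      have h6 := modEq_mul_of_newMod hb h4 h5
        ((add_mul_modEq h N i).trans (add_mul_modEq h N j).symm) (hi.trans hj.symm)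
      rw [Nat.cast_mul] at h6
      exact Int.natCast_modEq_iff.1 (Int.ModEq.mul_left_cancel' (by exact_mod_cast hN.ne')
        (Int.ModEq.add_left_cancel' h h6))
    have hinj : Set.InjOn a (Finset.Ico 1 b : Set ℕ) := by
      intro i hi j hj hij
      have h2 := ha' j hj
      rw [← hij] at h2
      have := key _ (ha i hi) i j (ha' i hi) h2
      simp at hi hj
      exact Nat.ModEq.eq_of_lt_of_lt this hi.2 hj.2
    have hsurj : (Finset.Ico 1 b).image a = newMods M N b := by
      refine Finset.eq_of_subset_of_card_le ?_ ?_
      · intro m hm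
        obtain ⟨j, hj, rfl⟩ := Finset.mem_image.1 hm
        exact ha j hj
      · rw [Finset.card_image_of_injOn hinj, Nat.card_Ico]
        omega
    intro m hm
    have hm' := hm
    rw [← hsurj] at hm'
    obtain ⟨j, hj, rfl⟩ := Finset.mem_image.1 hm'
    refine ⟨_, (hsingle _).2 (add_mul_modEq h N j), ha' j hj, fun m' hm' h' => ?_⟩
    have hm2 := hm'
    rw [← hsurj] at hm2
    obtain ⟨i, hi, rfl⟩ := Finset.mem_image.1 hm2
    have := key _ hm' i j (ha' i hi) h'
    simp at hi hj
    rw [Nat.ModEq.eq_of_lt_of_lt this hi.2 hj.2]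
  · rintro ⟨hf, ht, -, hh⟩
    have hdvd : ∀ m ∈ modsDividing M (N * b), m ∣ N * b := fun m hm => (mem_modsDividing.1 hm).2
    obtain ⟨h, hh⟩ := hh
    rw [uncovered_restrictTo] at hh
    refine ⟨by rwa [← modsDividing_union_newMods], (hasSingleHole_iff hdvd).2 ?_⟩
    have h1 := ncard_classesMod_add_card (separates_newMods hb (N := N) (M := M)
      fun z hz w hw => ((hh z).1 hz).trans ((hh w).1 hw).symm) ht
    rw [ncard_classesMod_of_hole hN hh, modsDividing_union_newMods] at h1
    omega

theorem ncard_singleHoleSystems_mul {M : Finset ℕ} {N b : ℕ} (hb : b.Prime) (hN : 0 < N)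
    (hcard : (newMods M N b).card + 1 = b) :
    (singleHoleSystems M (N * b)).ncard = (singleHoleSystems M N).ncard * b ! := by
  have : NeZero (N * b) := ⟨(Nat.mul_pos hN hb.pos).ne'⟩
  rw [singleHoleSystems_mul hb hN hcard, ncard_tight_stage (fun f hf => hf.1) (N * b) b
    (disjoint_modsDividing_newMods M N b)]
  · congr 1
    have : b.descFactorial (newMods M N b).card * (b - (newMods M N b).card)! = b ! := by
      rw [mul_comm]
      exact Nat.factorial_mul_descFactorial (by omega)
    rwa [show b - (newMods M N b).card = 1 by omega, Nat.factorial_one, mul_one] at this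
  · rintro f ⟨-, h, hh⟩
    exact separates_newMods hb fun z hz w hw => ((hh z).1 hz).trans ((hh w).1 hw).symm
  · rintro f ⟨-, h, hh⟩
    exact ncard_classesMod_of_hole hN hh

/-! ### The chain of divisors of Sun's number -/

/-- The divisors `p 1 ^ α 1 * ⋯ * p (s - 1) ^ α (s - 1) * p s ^ t` of Sun's number, along which
the coverings are analysed. -/
def chainModulus (p α : ℕ → ℕ) (s t : ℕ) : ℕ := (∏ i ∈ Finset.Ico 1 s, p i ^ α i) * p s ^ t

theorem chainModulus_succ (p α : ℕ → ℕ) (s t : ℕ) :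
    chainModulus p α s (t + 1) = chainModulus p α s t * p s := by
  simp [chainModulus, pow_succ, mul_assoc]

theorem chainModulus_eq_mul (p α : ℕ → ℕ) (s t : ℕ) :
    chainModulus p α s t = chainModulus p α s 0 * p s ^ t := by
  simp [chainModulus]

theorem chainModulus_block_succ (p α : ℕ → ℕ) {s : ℕ} (hs : 1 ≤ s) :
    chainModulus p α (s + 1) 0 = chainModulus p α s (α s) := by
  simp [chainModulus, Finset.prod_Ico_succ_top hs]

theorem chainModulus_one_zero (p α : ℕ → ℕ) : chainModulus p α 1 0 = 1 := by
  simp [chainModulus]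

namespace IsSunFactorization

variable {r : ℕ} {p α : ℕ → ℕ}

theorem lt_of_lt (hL : IsSunFactorization r p α) {i j : ℕ} (hi : 1 ≤ i) (hij : i < j)
    (hj : j ≤ r) : p i < p j := by
  induction j, hij using Nat.le_induction with
  | base => exact hL.increasing i hi (by omega)
  | succ k hk ih => exact (ih (by omega)).trans (hL.increasing k (by omega) (by omega))

theorem one_le_pred (hL : IsSunFactorization r p α) : 1 ≤ r - 1 := by
  have := hL.one_lt
  omega

theorem prime_pred (hL : IsSunFactorization r p α) : (p (r - 1)).Prime :=
  hL.prime _ hL.one_le_pred (by omega)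

theorem prime_last (hL : IsSunFactorization r p α) : (p r).Prime :=
  hL.prime r hL.one_lt.le le_rfl

theorem pred_lt_last (hL : IsSunFactorization r p α) : p (r - 1) < p r :=
  hL.lt_of_lt hL.one_le_pred (by have := hL.one_lt; omega) le_rfl

theorem coprime_chainModulus (hL : IsSunFactorization r p α) {s k : ℕ} (hsk : s ≤ k)
    (hk : 1 ≤ k) (hkr : k ≤ r) : (chainModulus p α s 0).Coprime (p k) := by
  simp only [chainModulus, pow_zero, mul_one]
  refine Nat.Coprime.prod_left fun i hi => ?_
  rw [Finset.mem_Ico] at hi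
  refine Nat.Coprime.pow_left _ ?_
  rw [Nat.coprime_primes (hL.prime i hi.1 (by omega)) (hL.prime k hk hkr)]
  exact (hL.lt_of_lt hi.1 (by omega) hkr).ne

theorem coprime_chainModulus_last (hL : IsSunFactorization r p α) (t : ℕ) :
    (chainModulus p α (r - 1) t).Coprime (p r) := by
  rw [chainModulus_eq_mul]
  refine Nat.Coprime.mul_left
    (hL.coprime_chainModulus (by omega) hL.one_lt.le le_rfl) (Nat.Coprime.pow_left _ ?_)
  rw [Nat.coprime_primes hL.prime_pred hL.prime_last]
  exact hL.pred_lt_last.ne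

theorem chainModulus_pos (hL : IsSunFactorization r p α) {s : ℕ} (hs : 1 ≤ s) (hsr : s ≤ r)
    (t : ℕ) : 0 < chainModulus p α s t := by
  refine Nat.mul_pos (Finset.prod_pos fun i hi => ?_) (Nat.pow_pos (hL.prime s hs hsr).pos)
  rw [Finset.mem_Ico] at hi
  exact Nat.pow_pos (hL.prime i hi.1 (by omega)).pos

theorem exponent_mul (hL : IsSunFactorization r p α) {t : ℕ} (ht : 1 ≤ t) (htr : t < r - 1) :
    (p t - 1) * (α t + 1) = p (t + 1) - 1 := by
  have h1 := (hL.prime t ht (by omega)).one_lt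
  have h2 := hL.increasing t ht (by omega)
  have hdvd : p t - 1 ∣ p (t + 1) - 1 :=
    (Nat.modEq_iff_dvd' (by omega)).1 (hL.modEq t ht htr).symm
  have hpos : 0 < (p (t + 1) - 1) / (p t - 1) := Nat.div_pos (by omega) (by omega)
  rw [hL.exponent t ht htr, Nat.sub_add_cancel hpos, Nat.mul_div_cancel' hdvd]

theorem card_divisors_chainModulus (hL : IsSunFactorization r p α) {s : ℕ} (hs : 1 ≤ s)
    (hsr : s ≤ r - 1) (t : ℕ) : (chainModulus p α s t).divisors.card = (p s - 1) * (t + 1) := by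
  have block : ∀ s, 1 ≤ s → s ≤ r - 1 → (chainModulus p α s 0).divisors.card = p s - 1 →
      ∀ t, (chainModulus p α s t).divisors.card = (p s - 1) * (t + 1) := by
    intro s hs hsr h t
    rw [chainModulus_eq_mul, Nat.Coprime.card_divisors_mul, h,
      Nat.divisors_prime_pow (hL.prime s hs (by omega))]
    · simp
    · exact Nat.Coprime.pow_right _ (hL.coprime_chainModulus le_rfl hs (by omega))
  refine block s hs hsr ?_ t
  induction s, hs using Nat.le_induction with
  | base => rw [chainModulus_one_zero, hL.first]; simp
  | succ k hk ih =>
    rw [chainModulus_block_succ p α hk, block k hk (by omega) (ih (by omega)),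
      hL.exponent_mul hk (by omega)]

theorem exponent_pred_mul_le (hL : IsSunFactorization r p α) :
    (p (r - 1) - 1) * α (r - 1) ≤ p r - 1 := by
  rw [hL.exponent_pred]
  exact Nat.mul_div_le _ _

theorem one_le_exponent_pred (hL : IsSunFactorization r p α) : 1 ≤ α (r - 1) := by
  rw [hL.exponent_pred]
  have h1 := hL.prime_pred.one_lt
  have h2 := hL.pred_lt_last
  exact Nat.div_pos (by omega) (by omega)

/-- If `α (r - 1) ≥ 2` this is clear. Otherwise `p r < 2 * p (r - 1)`, and the lower bound for
`p r` leaves only `p (r - 1) = 5` and `p r = 7`. -/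
theorem mul_exponent_add_two_lt (hL : IsSunFactorization r p α) (hr : 1 < r - 1) :
    (p (r - 1) - 1) * (α (r - 1) + 2) < 2 * p r := by
  have h1 := hL.prime_pred.one_lt
  have h2 := hL.pred_lt_last
  have h3 := hL.exponent_pred_mul_le
  have h4 := hL.one_le_exponent_pred
  have h5 : 2 < p (r - 1) := by
    have := hL.lt_of_lt le_rfl hr (by omega)
    rwa [hL.first] at this
  have h7 := hL.last_ge
  have hp := hL.prime_pred
  have hq := hL.prime_last
  have h6 : p r - 1 < (p (r - 1) - 1) * (α (r - 1) + 1) := by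
    rw [hL.exponent_pred]
    exact Nat.lt_mul_div_succ _ (by omega)
  generalize p (r - 1) = a at *
  generalize p r = q at *
  generalize α (r - 1) = e at *
  rcases Nat.lt_or_ge 1 e with he | he
  · have : (a - 1) * (e + 2) ≤ (a - 1) * (e + e) := Nat.mul_le_mul_left _ (by omega)
    have h8 : (a - 1) * (e + e) = 2 * ((a - 1) * e) := by ring
    omega
  · obtain rfl : e = 1 := by omega
    have h9 : (q : ℤ) ≤ 2 * a - 2 := by omega
    have h10 : a < 6 := by
      by_contra hcon
      have : (6 : ℤ) ≤ a := by omega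
      nlinarith
    have h11 : q < 9 := by omega
    interval_cases a <;> interval_cases q <;> first | omega | (exfalso; revert hp hq; norm_num)

end IsSunFactorization

theorem card_newMods_le {M : Finset ℕ} {N b : ℕ} (hNb : N * b ≠ 0) :
    (newMods M N b).card ≤ (N * b).divisors.card - N.divisors.card := by
  have hsub : N.divisors ⊆ (N * b).divisors := Nat.divisors_subset_of_dvd hNb (dvd_mul_right N b)
  rw [← Finset.card_sdiff_of_subset hsub]
  refine Finset.card_le_card fun m hm => ?_
  obtain ⟨-, h1, h2⟩ := mem_newMods.1 hm
  simp [h1, h2, hNb]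

namespace IsSunFactorization

variable {r : ℕ} {p α : ℕ → ℕ}

theorem card_newMods_le (hL : IsSunFactorization r p α) (M : Finset ℕ) {s : ℕ} (hs : 1 ≤ s)
    (hsr : s ≤ r - 1) (t : ℕ) : (newMods M (chainModulus p α s t) (p s)).card ≤ p s - 1 := by
  have h := _root_.card_newMods_le (M := M) (N := chainModulus p α s t) (b := p s) (by
    rw [← chainModulus_succ]; exact (hL.chainModulus_pos hs (by omega) _).ne')
  rw [← chainModulus_succ, hL.card_divisors_chainModulus hs hsr,
    hL.card_divisors_chainModulus hs hsr] at h
  refine h.trans ?_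
  rw [← Nat.mul_sub]
  simp

theorem card_newMods_lt (hL : IsSunFactorization r p α) (M : Finset ℕ) {s : ℕ} (hs : 1 ≤ s)
    (hsr : s ≤ r - 1) (t : ℕ) : (newMods M (chainModulus p α s t) (p s)).card < p s := by
  have := hL.card_newMods_le M hs hsr t
  have := (hL.prime s hs (by omega)).pos
  omega

/-- A hole survives all further levels of the same prime. -/
theorem exists_uncovered_level (hL : IsSunFactorization r p α) {M : Finset ℕ} {f : ℕ → ℕ}
    {s : ℕ} (hs : 1 ≤ s) (hsr : s ≤ r - 1) {t t' : ℕ} (htt : t ≤ t') {x : ℤ}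
    (hx : x ∈ uncovered (modsDividing M (chainModulus p α s t)) f) :
    ∃ x' : ℤ, x' ≡ x [ZMOD (chainModulus p α s t : ℤ)] ∧
      x' ∈ uncovered (modsDividing M (chainModulus p α s t')) f := by
  induction t', htt using Nat.le_induction with
  | base => exact ⟨x, rfl, hx⟩
  | succ k hk ih =>
    obtain ⟨y, hy, hyU⟩ := ih
    obtain ⟨x', h1, h2⟩ := exists_uncovered_extension (hL.prime s hs (by omega))
      (hL.chainModulus_pos hs (by omega) k) (hL.card_newMods_lt M hs hsr k) hyU
    refine ⟨x', (h1.of_dvd ?_).trans hy, by rwa [chainModulus_succ]⟩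
    rw [chainModulus_eq_mul, chainModulus_eq_mul p α s k]
    exact_mod_cast Nat.mul_dvd_mul_left _ (Nat.pow_dvd_pow _ hk)

/-- A hole survives all levels of the primes `p s, …, p (s' - 1)`. -/
theorem exists_uncovered_block (hL : IsSunFactorization r p α) {M : Finset ℕ} {f : ℕ → ℕ}
    {s s' : ℕ} (hs : 1 ≤ s) (hss : s ≤ s') (hsr : s' ≤ r - 1) {x : ℤ}
    (hx : x ∈ uncovered (modsDividing M (chainModulus p α s 0)) f) :
    ∃ x' : ℤ, x' ≡ x [ZMOD (chainModulus p α s 0 : ℤ)] ∧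
      x' ∈ uncovered (modsDividing M (chainModulus p α s' 0)) f := by
  induction s', hss using Nat.le_induction with
  | base => exact ⟨x, rfl, hx⟩
  | succ k hk ih =>
    obtain ⟨y, hy, hyU⟩ := ih (by omega)
    obtain ⟨x', h1, h2⟩ := hL.exists_uncovered_level (by omega) (by omega) (Nat.zero_le (α k)) hyU
    refine ⟨x', (h1.of_dvd ?_).trans hy, by rwa [chainModulus_block_succ p α (by omega)]⟩
    simp only [chainModulus, pow_zero, mul_one]
    exact_mod_cast Finset.prod_dvd_prod_of_subset _ _ _
      (Finset.Ico_subset_Ico_right hk)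

end IsSunFactorization

theorem dvd_mul_pow_pred {a b m t n : ℕ} (hb : b.Prime) (hm : m ∣ a * b ^ n) (ht : 1 ≤ t)
    (hmt : ¬ b ^ t ∣ m) : m ∣ a * b ^ (t - 1) := by
  obtain ⟨m₁, m₂, h1, h2, rfl⟩ := exists_dvd_and_dvd_of_dvd_mul hm
  obtain ⟨i, -, rfl⟩ := (Nat.dvd_prime_pow hb).1 h2
  refine Nat.mul_dvd_mul h1 (Nat.pow_dvd_pow _ ?_)
  by_contra hcon
  exact hmt ((Nat.pow_dvd_pow b (by omega)).mul_left m₁)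

namespace IsSunFactorization

variable {r : ℕ} {p α : ℕ → ℕ}

/-- Two holes that differ modulo `p (r - 1) ^ t` produce `2 * p r` classes which have to be covered
by the moduli divisible by `p r`, and only those not divisible by `p (r - 1) ^ t` cover two. -/
theorem two_mul_last_le (hL : IsSunFactorization r p α) {M : Finset ℕ} {f : ℕ → ℕ}
    (hM : ∀ m ∈ M, m ∣ chainModulus p α (r - 1) (α (r - 1)) * p r) (hf : uncovered M f = ∅)
    {x y : ℤ} (hx : x ∈ uncovered (modsDividing M (chainModulus p α (r - 1) (α (r - 1)))) f)
    (hy : y ∈ uncovered (modsDividing M (chainModulus p α (r - 1) (α (r - 1)))) f)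
    {t : ℕ} (ht : 1 ≤ t) (htα : t ≤ α (r - 1))
    (hxy : ¬ x ≡ y [ZMOD ((p (r - 1) ^ t : ℕ) : ℤ)]) :
    2 * p r ≤ (p (r - 1) - 1) * (α (r - 1) + 1 + t) := by
  have hr1 := hL.one_le_pred
  have hq := hL.prime_last
  set K := chainModulus p α (r - 1) (α (r - 1)) with hK
  have hKpos : 0 < K := hL.chainModulus_pos hr1 (by omega) _
  have hall : modsDividing M (K * p r) = M := Finset.filter_true_of_mem hM
  have hcov : ∀ z : ℤ, z ∉ uncovered (modsDividing M (K * p r)) f := by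
    rw [hall, hf]
    exact fun z => Set.notMem_empty z
  have hdvdK : p (r - 1) ^ t ∣ K := by
    rw [hK, chainModulus_eq_mul]
    exact (Nat.pow_dvd_pow _ htα).mul_left _
  set N := chainModulus p α (r - 1) (t - 1) with hN
  have hNpos : 0 < N := hL.chainModulus_pos hr1 (by omega) _
  have h1 := card_add_card_le hq hKpos hx hy (Finset.Subset.refl _) (Finset.Subset.refl _)
    (fun j _ => hcov _) (fun j _ => hcov _)
    (T := (newMods M K (p r)).filter fun m => ¬ p (r - 1) ^ t ∣ m) (by
      intro m hm i j hij
      refine Finset.mem_filter.2 ⟨hm, fun hdvd => hxy ?_⟩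
      have h2 : ((p (r - 1) ^ t : ℕ) : ℤ) ∣ K := by exact_mod_cast hdvdK
      exact (((add_mul_modEq x K i).of_dvd h2).symm.trans
        (hij.of_dvd (by exact_mod_cast hdvd))).trans ((add_mul_modEq y K j).of_dvd h2))
  have h2 : (newMods M K (p r)).card ≤ (p (r - 1) - 1) * (α (r - 1) + 1) := by
    have := _root_.card_newMods_le (M := M) (N := K) (b := p r) (Nat.mul_pos hKpos hq.pos).ne'
    rw [(hL.coprime_chainModulus_last _).card_divisors_mul, hq.divisors,
      Finset.card_pair hq.one_lt.ne, hL.card_divisors_chainModulus hr1 le_rfl] at this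
    omega
  have h3 : ((newMods M K (p r)).filter fun m => ¬ p (r - 1) ^ t ∣ m).card ≤
      (p (r - 1) - 1) * t := by
    have h4 : ((newMods M K (p r)).filter fun m => ¬ p (r - 1) ^ t ∣ m) ⊆ newMods M N (p r) := by
      intro m hm
      obtain ⟨h5, h6⟩ := Finset.mem_filter.1 hm
      obtain ⟨h7, h8, h9⟩ := mem_newMods.1 h5
      refine mem_newMods.2 ⟨h7, ?_, fun h => h9 (h.trans ?_)⟩
      · rw [hK, chainModulus_eq_mul, mul_right_comm] at h8
        rw [hN, chainModulus_eq_mul, mul_right_comm]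
        exact dvd_mul_pow_pred hL.prime_pred h8 ht h6
      · rw [hN, hK, chainModulus_eq_mul, chainModulus_eq_mul p α (r - 1) (α (r - 1))]
        exact Nat.mul_dvd_mul_left _ (Nat.pow_dvd_pow _ (by omega))
    have := _root_.card_newMods_le (M := M) (N := N) (b := p r) (Nat.mul_pos hNpos hq.pos).ne'
    rw [(hL.coprime_chainModulus_last _).card_divisors_mul, hq.divisors,
      Finset.card_pair hq.one_lt.ne, hL.card_divisors_chainModulus hr1 le_rfl,
      Nat.sub_add_cancel ht] at this
    have := Finset.card_le_card h4
    omega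
  rw [Finset.card_range] at h1
  calc 2 * p r = p r + p r := two_mul _
    _ ≤ _ := h1
    _ ≤ _ := add_le_add h2 h3
    _ = _ := by ring

/-- Before the moduli divisible by `p (r - 1)` come in, two holes are impossible: already modulo
`p (r - 1)` they would lead to two different holes. -/
theorem modEq_of_uncovered (hL : IsSunFactorization r p α) {M : Finset ℕ} {f : ℕ → ℕ}
    (hM : ∀ m ∈ M, m ∣ chainModulus p α (r - 1) (α (r - 1)) * p r) (hf : uncovered M f = ∅)
    (hr : 1 < r - 1) {x y : ℤ} (hx : x ∈ uncovered (modsDividing M (chainModulus p α (r - 1) 0)) f)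
    (hy : y ∈ uncovered (modsDividing M (chainModulus p α (r - 1) 0)) f) :
    x ≡ y [ZMOD (chainModulus p α (r - 1) 0 : ℤ)] := by
  classical
  by_contra hxy
  have hr1 := hL.one_le_pred
  have hb := hL.prime_pred
  have hb1 := hb.one_lt
  set N := chainModulus p α (r - 1) 0 with hN
  have hNpos : 0 < N := hL.chainModulus_pos hr1 (by omega) _
  set b := p (r - 1) with hbdef
  have hcop : N.Coprime b := hL.coprime_chainModulus le_rfl hr1 (by omega)
  -- All holes modulo `N * b` agree modulo `b`.
  have hagree : ∀ u ∈ uncovered (modsDividing M (N * b)) f,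
      ∀ v ∈ uncovered (modsDividing M (N * b)) f, u ≡ v [ZMOD (b : ℤ)] := by
    intro u hu v hv
    by_contra huv
    have hNb : N * b = chainModulus p α (r - 1) 1 := (chainModulus_succ p α (r - 1) 0).symm
    rw [hNb] at hu hv
    obtain ⟨u', hu1, hu2⟩ := hL.exists_uncovered_level hr1 le_rfl hL.one_le_exponent_pred hu
    obtain ⟨v', hv1, hv2⟩ := hL.exists_uncovered_level hr1 le_rfl hL.one_le_exponent_pred hv
    have hdvd : (b : ℤ) ∣ (chainModulus p α (r - 1) 1 : ℕ) := by
      rw [← hNb]; push_cast; exact dvd_mul_left _ _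
    have := hL.two_mul_last_le hM hf hu2 hv2 le_rfl hL.one_le_exponent_pred (by
      rw [pow_one]
      exact fun h => huv (((hu1.of_dvd hdvd).symm.trans h).trans (hv1.of_dvd hdvd)))
    rw [add_assoc, one_add_one_eq_two] at this
    have := hL.mul_exponent_add_two_lt hr
    omega
  -- Hence at least `b - 1` translates of each hole are covered at the next level.
  have hcount : ∀ x : ℤ, ∃ J ⊆ Finset.range b, b - 1 ≤ J.card ∧
      ∀ j ∈ J, x + N * (j : ℤ) ∉ uncovered (modsDividing M (N * b)) f := by
    intro x
    refine ⟨(Finset.range b).filter fun j : ℕ =>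
      x + N * (j : ℤ) ∉ uncovered (modsDividing M (N * b)) f, Finset.filter_subset _ _, ?_,
      fun j hj => (Finset.mem_filter.1 hj).2⟩
    have h1 := Finset.card_filter_add_card_filter_not (s := Finset.range b)
      (fun j : ℕ => x + N * (j : ℤ) ∉ uncovered (modsDividing M (N * b)) f)
    have h2 : ((Finset.range b).filter fun j : ℕ =>
        ¬ (x + N * (j : ℤ) ∉ uncovered (modsDividing M (N * b)) f)).card ≤ 1 := by
      rw [Finset.card_le_one]
      intro i hi j hj
      simp only [not_not, Finset.mem_filter, Finset.mem_range] at hi hj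
      have h3 := Int.ModEq.add_left_cancel' x (hagree _ hi.2 _ hj.2)
      have h4 : N * i ≡ N * j [MOD b] := by
        rw [← Int.natCast_modEq_iff]
        exact_mod_cast h3
      exact Nat.ModEq.eq_of_lt_of_lt
        (Nat.ModEq.cancel_left_of_coprime (by rw [Nat.gcd_comm]; exact hcop) h4) hi.1 hj.1
    rw [Finset.card_range] at h1
    omega
  obtain ⟨I, hI, hIc, hI'⟩ := hcount x
  obtain ⟨J, hJ, hJc, hJ'⟩ := hcount y
  have hle := card_add_card_le hb hNpos hx hy hI hJ hI' hJ'
    (T := (newMods M N b).erase (N * b)) (by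
      intro m hm i j hij
      refine Finset.mem_erase.2 ⟨?_, hm⟩
      rintro rfl
      have hdvd : (N : ℤ) ∣ ((N * b : ℕ) : ℤ) := by push_cast; exact dvd_mul_right _ _
      exact hxy (((add_mul_modEq x N i).symm.trans (hij.of_dvd hdvd)).trans
        (add_mul_modEq y N j)))
  have hN1 := hL.card_newMods_le M hr1 le_rfl 0
  rw [← hN, ← hbdef] at hN1
  -- Adjoining `N * b` to the moduli keeps the bound `b - 1`, so without it there are at most `b - 2`.
  have herase : ((newMods M N b).erase (N * b)).card ≤ b - 2 := by
    have h1 : newMods M N b ∪ {N * b} ⊆ newMods (newMods M N b ∪ {N * b}) N b := by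
      intro m hm
      refine mem_newMods.2 ⟨hm, ?_⟩
      rcases Finset.mem_union.1 hm with h | h
      · exact (mem_newMods.1 h).2
      · rw [Finset.mem_singleton.1 h]
        refine ⟨dvd_rfl, fun h => ?_⟩
        have := Nat.le_of_dvd hNpos h
        nlinarith
    have h2 := hL.card_newMods_le (newMods M N b ∪ {N * b}) hr1 le_rfl 0
    rw [← hN, ← hbdef] at h2
    have h3 := (Finset.card_le_card h1).trans h2
    have h4 : (newMods M N b).erase (N * b) ⊂ newMods M N b ∪ {N * b} := by
      refine Finset.ssubset_iff_subset_ne.2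
        ⟨(Finset.erase_subset _ _).trans Finset.subset_union_left, fun h => ?_⟩
      have : N * b ∈ (newMods M N b).erase (N * b) := h ▸ by simp
      simp at this
    have := Finset.card_lt_card h4
    omega
  omega

/-- The holes inside one class of the previous level form a single class, at every level before
that of `p (r - 1) ^ α (r - 1)`. -/
theorem not_two_holes (hL : IsSunFactorization r p α) {M : Finset ℕ} {f : ℕ → ℕ}
    (hM : ∀ m ∈ M, m ∣ chainModulus p α (r - 1) (α (r - 1)) * p r) (hf : uncovered M f = ∅)
    {s t : ℕ} (hs : 1 ≤ s) (hst : (s < r - 1 ∧ t < α s) ∨ (s = r - 1 ∧ t + 1 < α s)) {x y : ℤ}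
    (hx : x ∈ uncovered (modsDividing M (chainModulus p α s (t + 1))) f)
    (hy : y ∈ uncovered (modsDividing M (chainModulus p α s (t + 1))) f)
    (hxy : x ≡ y [ZMOD (chainModulus p α s t : ℤ)]) :
    x ≡ y [ZMOD (chainModulus p α s (t + 1) : ℤ)] := by
  rcases hst with ⟨hsr, ht⟩ | ⟨rfl, ht⟩
  · obtain ⟨x₁, hx1, hx1U⟩ := hL.exists_uncovered_level hs hsr.le (Nat.succ_le_of_lt ht) hx
    obtain ⟨y₁, hy1, hy1U⟩ := hL.exists_uncovered_level hs hsr.le (Nat.succ_le_of_lt ht) hy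
    rw [← chainModulus_block_succ p α hs] at hx1U hy1U
    obtain ⟨x₂, hx2, hx2U⟩ := hL.exists_uncovered_block (by omega) (Nat.succ_le_of_lt hsr) le_rfl
      hx1U
    obtain ⟨y₂, hy2, hy2U⟩ := hL.exists_uncovered_block (by omega) (Nat.succ_le_of_lt hsr) le_rfl
      hy1U
    have h := hL.modEq_of_uncovered hM hf (by omega) hx2U hy2U
    have hd1 : chainModulus p α (s + 1) 0 ∣ chainModulus p α (r - 1) 0 := by
      simp only [chainModulus, pow_zero, mul_one]
      exact Finset.prod_dvd_prod_of_subset _ _ _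
        (Finset.Ico_subset_Ico_right (Nat.succ_le_of_lt hsr))
    have hd2 : chainModulus p α s (t + 1) ∣ chainModulus p α (s + 1) 0 := by
      rw [chainModulus_block_succ p α hs, chainModulus_eq_mul,
        chainModulus_eq_mul p α s (α s)]
      exact Nat.mul_dvd_mul_left _ (Nat.pow_dvd_pow _ (Nat.succ_le_of_lt ht))
    have h3 := (hx2.symm.trans (h.of_dvd (by exact_mod_cast hd1))).trans hy2
    exact (hx1.symm.trans (h3.of_dvd (by exact_mod_cast hd2))).trans hy1
  · by_contra hcon
    obtain ⟨x₁, hx1, hx1U⟩ := hL.exists_uncovered_level hs le_rfl ht.le hx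
    obtain ⟨y₁, hy1, hy1U⟩ := hL.exists_uncovered_level hs le_rfl ht.le hy
    have h := hL.two_mul_last_le hM hf hx1U hy1U (show 1 ≤ t + 1 by omega) ht.le (by
      intro h
      apply hcon
      have hd : p (r - 1) ^ (t + 1) ∣ chainModulus p α (r - 1) (t + 1) := dvd_mul_left _ _
      have hd' : ((p (r - 1) ^ (t + 1) : ℕ) : ℤ) ∣ (chainModulus p α (r - 1) (t + 1) : ℕ) := by
        exact_mod_cast hd
      have h1 := ((hx1.of_dvd hd').symm.trans h).trans (hy1.of_dvd hd')
      have h2 : x ≡ y [ZMOD (chainModulus p α (r - 1) 0 : ℕ)] :=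
        hxy.of_dvd (by rw [chainModulus_eq_mul p α (r - 1) t]; push_cast; exact dvd_mul_right _ _)
      rw [chainModulus_eq_mul, Nat.cast_mul]
      refine (Int.modEq_and_modEq_iff_modEq_mul ?_).1 ⟨h2, h1⟩
      rw [Int.natAbs_natCast, Int.natAbs_natCast]
      exact Nat.Coprime.pow_right _ (hL.coprime_chainModulus le_rfl hs (by omega)))
    have h1 : (p (r - 1) - 1) * (α (r - 1) + 1 + (t + 1)) ≤
        (p (r - 1) - 1) * (2 * α (r - 1)) := Nat.mul_le_mul_left _ (by omega)
    have h2 := hL.exponent_pred_mul_le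
    have h3 := hL.prime_last.pos
    have h4 : (p (r - 1) - 1) * (2 * α (r - 1)) = 2 * ((p (r - 1) - 1) * α (r - 1)) := by ring
    omega

/-- In a covering in which every modulus has a private point, all levels below the level of
`p (r - 1) ^ α (r - 1)` are full and leave a single hole. -/
theorem level_step (hL : IsSunFactorization r p α) {M : Finset ℕ} {f : ℕ → ℕ}
    (hM : ∀ m ∈ M, m ∣ chainModulus p α (r - 1) (α (r - 1)) * p r) (hf : uncovered M f = ∅)
    (hpriv : ∀ m ∈ M, ∃ z : ℤ, z ≡ (f m : ℤ) [ZMOD (m : ℤ)] ∧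
      ∀ m' ∈ M, z ≡ (f m' : ℤ) [ZMOD (m' : ℤ)] → m' = m)
    {s t : ℕ} (hs : 1 ≤ s) (hst : (s < r - 1 ∧ t < α s) ∨ (s = r - 1 ∧ t + 1 < α s))
    (hh : HasSingleHole (modsDividing M (chainModulus p α s t)) f (chainModulus p α s t)) :
    (newMods M (chainModulus p α s t) (p s)).card + 1 = p s ∧
    HasSingleHole (modsDividing M (chainModulus p α s (t + 1))) f
      (chainModulus p α s (t + 1)) := by
  have hsr : s ≤ r - 1 := by omega
  have hb := hL.prime s hs (by omega)
  have hNpos := hL.chainModulus_pos hs (by omega) t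
  have hlt := hL.card_newMods_lt M hs hsr t
  have hnot := fun x hx y hy => hL.not_two_holes hM hf hs hst (x := x) (y := y) hx hy
  rw [chainModulus_succ] at hnot ⊢
  set N := chainModulus p α s t
  set b := p s
  have : NeZero (N * b) := ⟨(Nat.mul_pos hNpos hb.pos).ne'⟩
  have ht : IsTight (modsDividing M N) (newMods M N b) f :=
    isTight_of_private (Finset.filter_subset _ _) (Finset.filter_subset _ _)
      (disjoint_modsDividing_newMods M N b) hpriv
  obtain ⟨h, hh⟩ := hh
  have hHN : ∀ z ∈ uncovered (modsDividing M N) f, ∀ w ∈ uncovered (modsDividing M N) f,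
      z ≡ w [ZMOD (N : ℤ)] := fun z hz w hw => ((hh z).1 hz).trans ((hh w).1 hw).symm
  have h1 := ncard_classesMod_add_card (separates_newMods hb (M := M) hHN) ht
  rw [ncard_classesMod_of_hole hNpos hh, modsDividing_union_newMods] at h1
  have h2 : (classesMod (uncovered (modsDividing M (N * b)) f) (N * b)).ncard ≤ 1 := by
    rw [Set.ncard_le_one]
    rintro _ ⟨x, hx, rfl⟩ _ ⟨y, hy, rfl⟩
    refine zmod_eq_iff.2 (hnot x hx y hy (hHN x ?_ y ?_))
    · rw [← modsDividing_union_newMods] at hx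
      exact uncovered_mono Finset.subset_union_left f hx
    · rw [← modsDividing_union_newMods] at hy
      exact uncovered_mono Finset.subset_union_left f hy
  exact ⟨by omega, (hasSingleHole_iff fun m hm => (mem_modsDividing.1 hm).2).2 (by omega)⟩

theorem hasSingleHole_chain (hL : IsSunFactorization r p α) {M : Finset ℕ} {f : ℕ → ℕ}
    (hM : ∀ m ∈ M, m ∣ chainModulus p α (r - 1) (α (r - 1)) * p r) (h1M : 1 ∉ M)
    (hf : uncovered M f = ∅)
    (hpriv : ∀ m ∈ M, ∃ z : ℤ, z ≡ (f m : ℤ) [ZMOD (m : ℤ)] ∧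
      ∀ m' ∈ M, z ≡ (f m' : ℤ) [ZMOD (m' : ℤ)] → m' = m)
    {s t : ℕ} (hs : 1 ≤ s) (hst : (s < r - 1 ∧ t ≤ α s) ∨ (s = r - 1 ∧ t < α s)) :
    HasSingleHole (modsDividing M (chainModulus p α s t)) f (chainModulus p α s t) := by
  have block : ∀ s, 1 ≤ s →
      HasSingleHole (modsDividing M (chainModulus p α s 0)) f (chainModulus p α s 0) →
      ∀ t, (s < r - 1 ∧ t ≤ α s) ∨ (s = r - 1 ∧ t < α s) →
      HasSingleHole (modsDividing M (chainModulus p α s t)) f (chainModulus p α s t) := by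
    intro s hs h0 t
    induction t with
    | zero => exact fun _ => h0
    | succ t ih =>
      intro hst
      exact (hL.level_step hM hf hpriv hs (by omega) (ih (by omega))).2
  refine block s hs ?_ t hst
  have hsr : s ≤ r - 1 := by omega
  clear hst
  induction s, hs using Nat.le_induction with
  | base =>
    refine ⟨0, fun z => ⟨fun _ => ?_, fun _ m hm => ?_⟩⟩
    · rw [chainModulus_one_zero]
      exact Int.modEq_one
    · rw [chainModulus_one_zero, mem_modsDividing, Nat.dvd_one] at hm
      exact absurd (hm.2 ▸ hm.1) h1M
  | succ k hk ih =>
    rw [chainModulus_block_succ p α hk]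
    exact block k hk (ih (by omega)) (α k) (by omega)

/-- The number of ways to choose the residues of the moduli below the level of
`p (r - 1) ^ α (r - 1)`. -/
theorem ncard_singleHoleSystems_chain (hL : IsSunFactorization r p α) {M : Finset ℕ}
    (h1M : 1 ∉ M)
    (hfull : ∀ s t, 1 ≤ s → (s < r - 1 ∧ t < α s) ∨ (s = r - 1 ∧ t + 1 < α s) →
      (newMods M (chainModulus p α s t) (p s)).card + 1 = p s) {s t : ℕ} (hs : 1 ≤ s)
    (hst : (s < r - 1 ∧ t ≤ α s) ∨ (s = r - 1 ∧ t < α s)) :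
    (singleHoleSystems M (chainModulus p α s t)).ncard =
      (∏ i ∈ Finset.Ico 1 s, (p i)! ^ α i) * (p s)! ^ t := by
  have block : ∀ s, 1 ≤ s → (singleHoleSystems M (chainModulus p α s 0)).ncard =
        (∏ i ∈ Finset.Ico 1 s, (p i)! ^ α i) →
      ∀ t, (s < r - 1 ∧ t ≤ α s) ∨ (s = r - 1 ∧ t < α s) →
      (singleHoleSystems M (chainModulus p α s t)).ncard =
        (∏ i ∈ Finset.Ico 1 s, (p i)! ^ α i) * (p s)! ^ t := by
    intro s hs h0 t
    induction t with
    | zero => exact fun _ => by simpa using h0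
    | succ t ih =>
      intro hst
      rw [chainModulus_succ, ncard_singleHoleSystems_mul (hL.prime s hs (by omega))
        (hL.chainModulus_pos hs (by omega) t) (hfull s t hs (by omega)), ih (by omega), pow_succ,
        mul_assoc]
  refine block s hs ?_ t hst
  have hsr : s ≤ r - 1 := by omega
  clear hst
  induction s, hs using Nat.le_induction with
  | base =>
    have hempty : modsDividing M 1 = ∅ := by
      refine Finset.filter_eq_empty_iff.2 fun m hm h => ?_
      rw [Nat.dvd_one] at h
      exact h1M (h ▸ hm)
    rw [chainModulus_one_zero, Finset.Ico_self, Finset.prod_empty, Set.ncard_eq_one]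
    refine ⟨0, ?_⟩
    ext f
    simp only [singleHoleSystems, hempty, Set.mem_ofPred_eq, Set.mem_singleton_iff]
    constructor
    · rintro ⟨hf, -⟩
      funext m
      exact hf.2 m (Finset.notMem_empty m)
    · rintro rfl
      exact ⟨⟨by simp, by simp⟩, 0, fun z =>
        ⟨fun _ => by rw [Nat.cast_one]; exact Int.modEq_one, fun _ => by simp [uncovered]⟩⟩
  | succ k hk ih =>
    rw [chainModulus_block_succ p α hk, block k hk (ih (by omega)) (α k) (by omega),
      Finset.prod_Ico_succ_top hk]

end IsSunFactorization

/-! ### The grid of the last two primes -/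

/-- The moduli in `M` that divide neither `N * b` nor `N * q`. -/
def mixedMods (M : Finset ℕ) (N b q : ℕ) : Finset ℕ :=
  M.filter fun m => ¬ m ∣ N * b ∧ ¬ m ∣ N * q

theorem modEq_mul_mul_of_mixedMod {N b q m : ℕ} (hb : b.Prime) (hq : q.Prime) (hbq : b ≠ q)
    (hN : 0 < N) (hm : m ∣ N * b * q) (hmb : ¬ m ∣ N * b) (hmq : ¬ m ∣ N * q) {z w : ℤ}
    (hzw : z ≡ w [ZMOD (N : ℤ)]) (h : z ≡ w [ZMOD (m : ℤ)]) :
    z ≡ w [ZMOD ((N * b * q : ℕ) : ℤ)] := by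
  obtain ⟨k, hk⟩ := Nat.dvd_lcm_left N m
  have hmk : m ∣ N * k := hk ▸ Nat.dvd_lcm_right N m
  have hkb : k ∣ b * q := by
    have : N * k ∣ N * (b * q) :=
      hk ▸ Nat.lcm_dvd (dvd_mul_right N _) (by rwa [← mul_assoc])
    exact Nat.dvd_of_mul_dvd_mul_left hN this
  have h1 : b ∣ k := by
    by_contra hcon
    have hc : k.Coprime b := ((Nat.Prime.coprime_iff_not_dvd hb).2 hcon).symm
    exact hmq (hmk.trans (Nat.mul_dvd_mul_left N (hc.dvd_of_dvd_mul_left hkb)))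
  have h2 : q ∣ k := by
    by_contra hcon
    have hc : k.Coprime q := ((Nat.Prime.coprime_iff_not_dvd hq).2 hcon).symm
    exact hmb (hmk.trans (Nat.mul_dvd_mul_left N (hc.dvd_of_dvd_mul_right hkb)))
  have h3 : N * b * q ∣ Nat.lcm N m := by
    rw [hk, mul_assoc]
    exact Nat.mul_dvd_mul_left N
      (Nat.Coprime.mul_dvd_of_dvd_of_dvd ((Nat.coprime_primes hb hq).2 hbq) h1 h2)
  rw [Int.modEq_iff_dvd] at *
  rw [Int.natCast_dvd] at *
  exact h3.trans (Nat.lcm_dvd hzw h)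

theorem exists_modEq_modEq {N b q : ℕ} (hbq : b.Coprime q) {z w : ℤ}
    (h : z ≡ w [ZMOD (N : ℤ)]) :
    ∃ v : ℤ, v ≡ z [ZMOD ((N * b : ℕ) : ℤ)] ∧ v ≡ w [ZMOD ((N * q : ℕ) : ℤ)] := by
  obtain ⟨c, hc⟩ := h.dvd
  obtain ⟨u, v, huv⟩ := Nat.isCoprime_iff_coprime.2 hbq
  refine ⟨z + N * b * (u * c), ?_, ?_⟩
  · rw [Nat.cast_mul]
    simp [Int.ModEq]
  · rw [Int.modEq_iff_dvd, Nat.cast_mul]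
    refine ⟨c * v, ?_⟩
    have : w = z + N * c := by linarith
    rw [this]
    linear_combination (-N * c : ℤ) * huv

theorem restrictTo_restrictTo {S S' : Finset ℕ} (h : S ⊆ S') (f : ℕ → ℕ) :
    restrictTo S (restrictTo S' f) = restrictTo S f := by
  funext m
  by_cases hm : m ∈ S
  · rw [restrictTo_apply_mem hm, restrictTo_apply_mem hm, restrictTo_apply_mem (h hm)]
  · rw [restrictTo_apply_notMem hm, restrictTo_apply_notMem hm]

theorem isTight_restrictTo {S T R : Finset ℕ} (h : S ∪ T ⊆ R) {f : ℕ → ℕ} :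
    IsTight S T (restrictTo R f) ↔ IsTight S T f :=
  isTight_congr fun _ hm => restrictTo_apply_mem (h hm)

/-- The moduli in `M` that divide `N * b` or `N * q`. -/
def pairMods (M : Finset ℕ) (N b q : ℕ) : Finset ℕ :=
  modsDividing M (N * b) ∪ newMods M N q

section Grid

variable {M : Finset ℕ} {N b q : ℕ}

theorem dvd_of_dvd_mul_of_dvd_mul (hbq : b.Coprime q) {m : ℕ} (h1 : m ∣ N * b)
    (h2 : m ∣ N * q) : m ∣ N := by
  have := Nat.dvd_gcd h1 h2
  rwa [Nat.gcd_mul_left, hbq.gcd_eq_one, mul_one] at this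

theorem disjoint_modsDividing_newMods_of_coprime (hbq : b.Coprime q) :
    Disjoint (modsDividing M (N * b)) (newMods M N q) := by
  rw [Finset.disjoint_left]
  intro m hm hm'
  obtain ⟨-, h1, h2⟩ := mem_newMods.1 hm'
  exact h2 (dvd_of_dvd_mul_of_dvd_mul hbq (mem_modsDividing.1 hm).2 h1)

theorem disjoint_pairMods_mixedMods :
    Disjoint (pairMods M N b q) (mixedMods M N b q) := by
  rw [Finset.disjoint_left]
  intro m hm hm'
  obtain ⟨-, h1, h2⟩ := Finset.mem_filter.1 hm'
  rcases Finset.mem_union.1 hm with h | h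
  · exact h1 (mem_modsDividing.1 h).2
  · exact h2 (mem_newMods.1 h).2.1

theorem pairMods_union_mixedMods : pairMods M N b q ∪ mixedMods M N b q = M := by
  ext m
  simp only [pairMods, mixedMods, Finset.mem_union, mem_modsDividing, mem_newMods,
    Finset.mem_filter]
  have : m ∣ N → m ∣ N * b := fun h => h.mul_right b
  tauto

theorem newMods_subset : newMods M N b ⊆ M := Finset.filter_subset _ _

theorem modsDividing_subset : modsDividing M N ⊆ M := Finset.filter_subset _ _

theorem pairMods_subset : pairMods M N b q ⊆ M :=
  Finset.union_subset modsDividing_subset newMods_subset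

/-- Starting from one class modulo `N`, viewed as a `b × q` grid of classes modulo `N * b * q`,
the new moduli for `b` remove rows and the new moduli for `q` remove columns. -/
theorem grid_count (hb : b.Prime) (hq : q.Prime) (hbq : b ≠ q) (hN : 0 < N) {f : ℕ → ℕ}
    (hh : HasSingleHole (modsDividing M N) f N) (hcard : (newMods M N b).card < b)
    (ht₁ : IsTight (modsDividing M N) (newMods M N b) f) :
    Separates (newMods M N b) (uncovered (modsDividing M N) f) (N * b) ∧
    (classesMod (uncovered (modsDividing M N) f) (N * b)).ncard = b ∧
    Separates (newMods M N q) (uncovered (modsDividing M (N * b)) f) (N * q) ∧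
    (classesMod (uncovered (modsDividing M (N * b)) f) (N * q)).ncard = q ∧
    (IsTight (modsDividing M (N * b)) (newMods M N q) f →
      (newMods M N q).card ≤ q ∧
      (classesMod (uncovered (pairMods M N b q) f) (N * b * q)).ncard =
        (b - (newMods M N b).card) * (q - (newMods M N q).card)) := by
  classical
  have : NeZero (N * b) := ⟨(Nat.mul_pos hN hb.pos).ne'⟩
  have : NeZero (N * q) := ⟨(Nat.mul_pos hN hq.pos).ne'⟩
  have hcop : b.Coprime q := (Nat.coprime_primes hb hq).2 hbq
  obtain ⟨h, hh⟩ := hh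
  have hS : ∀ m ∈ modsDividing M (N * b), m ∣ N * b := fun m hm => (mem_modsDividing.1 hm).2
  have hsub : uncovered (modsDividing M (N * b)) f ⊆ uncovered (modsDividing M N) f := by
    rw [← modsDividing_union_newMods]
    exact uncovered_mono Finset.subset_union_left f
  have hsub' : uncovered (pairMods M N b q) f ⊆ uncovered (modsDividing M (N * b)) f :=
    uncovered_mono Finset.subset_union_left f
  have hHN : ∀ z ∈ uncovered (modsDividing M N) f, ∀ w ∈ uncovered (modsDividing M N) f,
      z ≡ w [ZMOD (N : ℤ)] := fun z hz w hw => ((hh z).1 hz).trans ((hh w).1 hw).symm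
  have hsep₁ := separates_newMods hb (M := M) hHN
  have hsep₂ : Separates (newMods M N q) (uncovered (modsDividing M (N * b)) f) (N * q) :=
    separates_newMods hq fun z hz w hw => hHN z (hsub hz) w (hsub hw)
  have hc₁ := ncard_classesMod_of_hole (b := b) hN hh
  have hrows := ncard_classesMod_add_card hsep₁ ht₁
  rw [hc₁, modsDividing_union_newMods] at hrows
  -- Some row is left, and it meets every column.
  obtain ⟨_, w, hw, -⟩ : (classesMod (uncovered (modsDividing M (N * b)) f) (N * b)).Nonempty := by
    rw [← Set.ncard_pos]
    omega
  have hcol : classesMod (uncovered (modsDividing M (N * b)) f) (N * q) =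
      classesMod (uncovered (modsDividing M N) f) (N * q) := by
    refine Set.Subset.antisymm (Set.image_mono hsub) ?_
    rintro _ ⟨z, hz, rfl⟩
    obtain ⟨v, hv1, hv2⟩ := exists_modEq_modEq hcop (hHN w (hsub hw) z hz)
    exact ⟨v, uncovered_periodic hS hv1 hw, zmod_eq_iff.2 hv2⟩
  have hc₂ : (classesMod (uncovered (modsDividing M (N * b)) f) (N * q)).ncard = q := by
    rw [hcol]
    exact ncard_classesMod_of_hole hN hh
  refine ⟨hsep₁, hc₁, hsep₂, hc₂, fun ht₂ => ?_⟩
  have hcols := ncard_classesMod_add_card hsep₂ ht₂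
  rw [hc₂] at hcols
  refine ⟨by omega, ?_⟩
  rw [show b - (newMods M N b).card =
      (classesMod (uncovered (modsDividing M (N * b)) f) (N * b)).ncard by omega,
    show q - (newMods M N q).card =
      (classesMod (uncovered (pairMods M N b q) f) (N * q)).ncard by
        rw [pairMods]; omega, ← Set.ncard_prod]
  refine Set.BijOn.ncard_eq (f := fun c : ZMod (N * b * q) =>
    (ZMod.castHom (dvd_mul_right (N * b) q) (ZMod (N * b)) c,
      ZMod.castHom (show N * q ∣ N * b * q from ⟨b, by ring⟩) (ZMod (N * q)) c)) ⟨?_, ?_, ?_⟩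
  · rintro _ ⟨z, hz, rfl⟩
    exact ⟨⟨z, hsub' hz, by simp⟩, ⟨z, hz, by simp⟩⟩
  · rintro _ ⟨z, hz, rfl⟩ _ ⟨w, hw, rfl⟩ hzw
    simp only [Prod.mk.injEq, map_intCast] at hzw
    have h1 := zmod_eq_iff.1 hzw.1
    have h2 := zmod_eq_iff.1 hzw.2
    refine zmod_eq_iff.2 ?_
    rw [Int.modEq_iff_dvd, Int.natCast_dvd] at *
    have h3 := Nat.lcm_dvd h1 h2
    rwa [Nat.lcm_mul_left, hcop.lcm_eq_mul, ← mul_assoc] at h3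
  · rintro ⟨_, _⟩ ⟨⟨z, hz, rfl⟩, ⟨w, hw, rfl⟩⟩
    obtain ⟨v, hv1, hv2⟩ := exists_modEq_modEq hcop (hHN z (hsub hz) w (hsub (hsub' hw)))
    refine ⟨(v : ZMod (N * b * q)), ⟨v, mem_uncovered_union.2
      ⟨uncovered_periodic hS hv1 hz, fun m hm hvm => ?_⟩, rfl⟩, ?_⟩
    · refine (mem_uncovered_union.1 hw).2 m hm ((hv2.of_dvd ?_).symm.trans hvm)
      exact_mod_cast (mem_newMods.1 hm).2.1
    · simp only [map_intCast]
      exact Prod.ext (zmod_eq_iff.2 hv1) (zmod_eq_iff.2 hv2)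

theorem separates_mixedMods (hb : b.Prime) (hq : q.Prime) (hbq : b ≠ q) (hN : 0 < N)
    (hM : ∀ m ∈ M, m ∣ N * b * q) {H : Set ℤ}
    (hH : ∀ z ∈ H, ∀ w ∈ H, z ≡ w [ZMOD (N : ℤ)]) :
    Separates (mixedMods M N b q) H (N * b * q) := by
  intro m hm
  obtain ⟨h0, h1, h2⟩ := Finset.mem_filter.1 hm
  exact ⟨hM m h0, fun z hz w hw h =>
    modEq_mul_mul_of_mixedMod hb hq hbq hN (hM m h0) h1 h2 (hH z hz w hw) h⟩

/-- The residue systems on `M` that cover every integer. -/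
def coveringSystems (M : Finset ℕ) : Set (ℕ → ℕ) :=
  {f | f ∈ residueSystems M ∧ uncovered M f = ∅}

theorem HasSingleHole.modEq {S : Finset ℕ} {f : ℕ → ℕ} (hh : HasSingleHole S f N) :
    ∀ z ∈ uncovered S f, ∀ w ∈ uncovered S f, z ≡ w [ZMOD (N : ℤ)] := by
  obtain ⟨h, hh⟩ := hh
  exact fun z hz w hw => ((hh z).1 hz).trans ((hh w).1 hw).symm

/-- The count for the last three stages (rows, columns and single cells of the grid). -/
theorem ncard_coveringSystems_grid (hb : b.Prime) (hq : q.Prime) (hbq : b ≠ q) (hN : 0 < N)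
    (hM : ∀ m ∈ M, m ∣ N * b * q) (hcard : (newMods M N b).card < b)
    (hpriv : ∀ f ∈ coveringSystems M, ∀ m ∈ M, ∃ z : ℤ, z ≡ (f m : ℤ) [ZMOD (m : ℤ)] ∧
      ∀ m' ∈ M, z ≡ (f m' : ℤ) [ZMOD (m' : ℤ)] → m' = m)
    (hhole : ∀ f ∈ coveringSystems M, HasSingleHole (modsDividing M N) f N)
    (hne : (coveringSystems M).Nonempty) :
    (newMods M N q).card ≤ q ∧
    (coveringSystems M).ncard = (singleHoleSystems M N).ncard *
      b.descFactorial (newMods M N b).card * q.descFactorial (newMods M N q).card *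
        (mixedMods M N b q).card ! := by
  classical
  have : NeZero (N * b) := ⟨(Nat.mul_pos hN hb.pos).ne'⟩
  have : NeZero (N * q) := ⟨(Nat.mul_pos hN hq.pos).ne'⟩
  have : NeZero (N * b * q) := ⟨(Nat.mul_pos (Nat.mul_pos hN hb.pos) hq.pos).ne'⟩
  have hcop : b.Coprime q := (Nat.coprime_primes hb hq).2 hbq
  set S₀ := modsDividing M N with hS₀
  set S₁ := modsDividing M (N * b) with hS₁
  set S₂ := pairMods M N b q with hS₂
  set T₁ := newMods M N b with hT₁
  set T₂ := newMods M N q with hT₂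
  set T₃ := mixedMods M N b q with hT₃
  have hU₁ : S₀ ∪ T₁ = S₁ := modsDividing_union_newMods M N b
  have hU₂ : S₁ ∪ T₂ = S₂ := rfl
  have hU₃ : S₂ ∪ T₃ = M := pairMods_union_mixedMods
  have h₀₁ : S₀ ⊆ S₁ := hU₁ ▸ Finset.subset_union_left
  have h₁₂ : S₁ ⊆ S₂ := Finset.subset_union_left
  have h₂ : S₂ ⊆ M := pairMods_subset
  have hd₁ : Disjoint S₀ T₁ := disjoint_modsDividing_newMods M N b
  have hd₂ : Disjoint S₁ T₂ := disjoint_modsDividing_newMods_of_coprime hcop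
  have hd₃ : Disjoint S₂ T₃ := disjoint_pairMods_mixedMods
  have htight : ∀ f ∈ coveringSystems M, IsTight S₀ T₁ f ∧ IsTight S₁ T₂ f ∧ IsTight S₂ T₃ f :=
    fun f hf =>
      ⟨isTight_of_private modsDividing_subset newMods_subset hd₁ (hpriv f hf),
      isTight_of_private modsDividing_subset newMods_subset hd₂ (hpriv f hf),
      isTight_of_private h₂ (Finset.filter_subset _ _) hd₃ (hpriv f hf)⟩
  have hsep₃ : ∀ f, HasSingleHole S₀ f N → Separates T₃ (uncovered S₂ f) (N * b * q) := by
    intro f hf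
    have hsub : uncovered S₂ f ⊆ uncovered S₀ f := uncovered_mono (h₀₁.trans h₁₂) f
    exact separates_mixedMods hb hq hbq hN hM
      fun z hz w hw => hf.modEq z (hsub hz) w (hsub hw)
  -- A given covering determines the number of moduli of the last stage.
  obtain ⟨hT₂q, hT₃c⟩ : T₂.card ≤ q ∧ T₃.card = (b - T₁.card) * (q - T₂.card) := by
    obtain ⟨f, hf⟩ := hne
    obtain ⟨t1, t2, t3⟩ := htight f hf
    have hg := (grid_count hb hq hbq hN (hhole f hf) hcard t1).2.2.2.2 t2
    refine ⟨hg.1, ?_⟩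
    have h1 := ncard_classesMod_add_card (hsep₃ f (hhole f hf)) t3
    rw [hU₃, hf.2, hg.2] at h1
    simpa [classesMod] using h1
  refine ⟨hT₂q, ?_⟩
  set X₀ := singleHoleSystems M N with hX₀
  set X₁ := {f | f ∈ residueSystems (S₀ ∪ T₁) ∧ IsTight S₀ T₁ f ∧ restrictTo S₀ f ∈ X₀} with hX₁
  set X₂ := {f | f ∈ residueSystems (S₁ ∪ T₂) ∧ IsTight S₁ T₂ f ∧ restrictTo S₁ f ∈ X₁} with hX₂
  have hhole_of : ∀ f, restrictTo S₀ f ∈ X₀ → HasSingleHole S₀ f N := by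
    rintro f ⟨-, h⟩
    unfold HasSingleHole at h
    rwa [uncovered_restrictTo] at h
  have hX₁_hole : ∀ f ∈ X₁, HasSingleHole S₀ f N ∧ IsTight S₀ T₁ f :=
    fun f hf => ⟨hhole_of f hf.2.2, hf.2.1⟩
  have hX₂_hole : ∀ f ∈ X₂, HasSingleHole S₀ f N ∧ IsTight S₀ T₁ f ∧ IsTight S₁ T₂ f := by
    rintro f ⟨-, h1, -, h2, h3⟩
    rw [restrictTo_restrictTo h₀₁] at h3
    exact ⟨hhole_of f h3, (isTight_restrictTo hU₁.le).1 h2, h1⟩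
  have hcover : coveringSystems M =
      {f | f ∈ residueSystems (S₂ ∪ T₃) ∧ IsTight S₂ T₃ f ∧ restrictTo S₂ f ∈ X₂} := by
    ext f
    constructor
    · intro hf
      obtain ⟨t1, t2, t3⟩ := htight f hf
      refine ⟨hU₃.symm ▸ hf.1, t3, ?_, (isTight_restrictTo hU₂.le).2 t2, ?_, ?_, ?_, ?_⟩
      · exact restrictTo_mem hf.1 h₂
      · rw [hU₁, restrictTo_restrictTo h₁₂]
        exact restrictTo_mem hf.1 (h₁₂.trans h₂)
      · rw [restrictTo_restrictTo h₁₂]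
        exact (isTight_restrictTo hU₁.le).2 t1
      · rw [restrictTo_restrictTo h₁₂, restrictTo_restrictTo h₀₁]
        exact restrictTo_mem hf.1 modsDividing_subset
      · rw [restrictTo_restrictTo h₁₂, restrictTo_restrictTo h₀₁]
        exact (hhole f hf).restrictTo
    · rintro ⟨hf, t3, hf2⟩
      obtain ⟨hh, t1, t2⟩ := hX₂_hole _ hf2
      have hg := ((grid_count hb hq hbq hN hh hcard t1).2.2.2.2 t2).2
      rw [uncovered_restrictTo] at hg
      have hh' : HasSingleHole S₀ f N := by
        refine hhole_of f ?_
        have := hf2.2.2.2.2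
        rwa [restrictTo_restrictTo h₁₂, restrictTo_restrictTo h₀₁] at this
      have h1 := ncard_classesMod_add_card (hsep₃ f hh') t3
      rw [hU₃, hg, ← hT₃c, add_eq_right, Set.ncard_eq_zero, classesMod, Set.image_eq_empty] at h1
      exact ⟨hU₃ ▸ hf, h1⟩
  have e₁ : X₁.ncard = X₀.ncard * b.descFactorial T₁.card := by
    refine ncard_tight_stage (fun f hf => hf.1) (N * b) b hd₁ ?_ ?_
    · exact fun f hf => separates_newMods hb hf.2.modEq
    · rintro f ⟨-, h, hh⟩
      exact ncard_classesMod_of_hole hN hh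
  have e₂ : X₂.ncard = X₁.ncard * q.descFactorial T₂.card := by
    refine ncard_tight_stage (fun f hf => hU₁ ▸ hf.1) (N * q) q hd₂ ?_ ?_
    · exact fun f hf => (grid_count hb hq hbq hN (hX₁_hole f hf).1 hcard (hX₁_hole f hf).2).2.2.1
    · exact fun f hf => (grid_count hb hq hbq hN (hX₁_hole f hf).1 hcard (hX₁_hole f hf).2).2.2.2.1
  rw [hcover, ncard_tight_stage (fun f hf => hf.1) (N * b * q) T₃.card hd₃
    (fun f hf => hsep₃ f (hX₂_hole f hf).1), e₂, e₁, Nat.descFactorial_self]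
  intro f hf
  obtain ⟨hh, t1, t2⟩ := hX₂_hole f hf
  rw [hT₃c]
  exact ((grid_count hb hq hbq hN hh hcard t1).2.2.2.2 t2).2

end Grid

/-! ### Coverings as residue systems, and the count -/

/-- The set of congruences `(f m, m)`, `m ∈ M`. -/
def congruences (M : Finset ℕ) (f : ℕ → ℕ) : Finset (ℕ × ℕ) := M.image fun m => (f m, m)

theorem mem_congruences {M : Finset ℕ} {f : ℕ → ℕ} {c : ℕ × ℕ} :
    c ∈ congruences M f ↔ c.2 ∈ M ∧ f c.2 = c.1 := by
  simp only [congruences, Finset.mem_image]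
  constructor
  · rintro ⟨m, hm, rfl⟩
    exact ⟨hm, rfl⟩
  · rintro ⟨h1, h2⟩
    exact ⟨c.2, h1, Prod.ext h2 rfl⟩

theorem congruences_mem {M : Finset ℕ} (hM : ∀ m ∈ M, 2 ≤ m) {f : ℕ → ℕ}
    (hf : f ∈ coveringSystems M) : congruences M f ∈ coveringsWithModuli M := by
  refine ⟨⟨fun c hc => ?_, fun c hc d hd h => ?_, fun z => ?_⟩, ?_⟩
  · obtain ⟨h1, h2⟩ := mem_congruences.1 hc
    exact ⟨hM _ h1, h2 ▸ hf.1.1 _ h1⟩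
  · obtain ⟨-, h1⟩ := mem_congruences.1 hc
    obtain ⟨-, h2⟩ := mem_congruences.1 hd
    exact Prod.ext (by rw [← h1, ← h2, h]) h
  · have : z ∉ uncovered M f := by rw [hf.2]; exact Set.notMem_empty z
    simp only [uncovered, Set.mem_ofPred_eq, not_forall, not_not] at this
    obtain ⟨m, hm, h⟩ := this
    exact ⟨(f m, m), mem_congruences.2 ⟨hm, rfl⟩, h⟩
  · rw [congruences, Finset.image_image]
    exact Finset.image_id

theorem exists_congruences_eq {M : Finset ℕ} {C : Finset (ℕ × ℕ)}
    (hC : C ∈ coveringsWithModuli M) : ∃ f ∈ coveringSystems M, congruences M f = C := by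
  classical
  obtain ⟨⟨h1, h2, h3⟩, rfl⟩ := hC
  have hex : ∀ m ∈ C.image Prod.snd, ∃ x, (x, m) ∈ C := by
    intro m hm
    obtain ⟨c, hc, rfl⟩ := Finset.mem_image.1 hm
    exact ⟨c.1, hc⟩
  choose! g hg using hex
  set f := restrictTo (C.image Prod.snd) g with hf
  have hmem : ∀ m ∈ C.image Prod.snd, (f m, m) ∈ C := by
    intro m hm
    rw [hf, restrictTo_apply_mem hm]
    exact hg m hm
  have huniq : ∀ c ∈ C, f c.2 = c.1 := fun c hc =>
    congrArg Prod.fst (h2 _ (hmem c.2 (Finset.mem_image_of_mem _ hc)) c hc rfl)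
  refine ⟨f, ⟨⟨fun m hm => (h1 _ (hmem m hm)).2, fun m hm => restrictTo_apply_notMem hm⟩, ?_⟩, ?_⟩
  · refine Set.eq_empty_of_forall_notMem fun z hz => ?_
    obtain ⟨c, hc, h⟩ := h3 z
    exact hz c.2 (Finset.mem_image_of_mem _ hc) (by rwa [huniq c hc])
  · ext c
    rw [mem_congruences]
    constructor
    · rintro ⟨hc, h⟩
      have := hmem _ hc
      rwa [h] at this
    · exact fun hc => ⟨Finset.mem_image_of_mem _ hc, huniq c hc⟩

theorem ncard_coveringsWithModuli {M : Finset ℕ} (hM : ∀ m ∈ M, 2 ≤ m) :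
    (coveringsWithModuli M).ncard = (coveringSystems M).ncard := by
  symm
  refine Set.BijOn.ncard_eq (f := congruences M) ⟨fun f hf => congruences_mem hM hf, ?_, ?_⟩
  · intro f hf g hg h
    funext m
    by_cases hm : m ∈ M
    · have : (f m, m) ∈ congruences M f := mem_congruences.2 ⟨hm, rfl⟩
      rw [h] at this
      exact (mem_congruences.1 this).2.symm
    · rw [hf.1.2 m hm, hg.1.2 m hm]
  · intro C hC
    exact exists_congruences_eq hC

/-- In a minimal covering every modulus has a private point. -/
theorem exists_private_of_isMinimalCovering {M : Finset ℕ} {f : ℕ → ℕ}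
    (h : IsMinimalCovering (congruences M f)) : ∀ m ∈ M, ∃ z : ℤ, z ≡ (f m : ℤ) [ZMOD (m : ℤ)] ∧
      ∀ m' ∈ M, z ≡ (f m' : ℤ) [ZMOD (m' : ℤ)] → m' = m := by
  classical
  intro m hm
  have hmem : (f m, m) ∈ congruences M f := mem_congruences.2 ⟨hm, rfl⟩
  have herase := Finset.erase_ssubset hmem
  have hnot := h.2 _ herase
  obtain ⟨⟨h1, h2, h3⟩, -⟩ := h
  have : ∃ z : ℤ, ∀ c ∈ (congruences M f).erase (f m, m), ¬ z ≡ (c.1 : ℤ) [ZMOD (c.2 : ℤ)] := by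
    by_contra! hcon
    exact hnot ⟨fun c hc => h1 c (herase.1 hc),
      fun c hc d hd => h2 c (herase.1 hc) d (herase.1 hd), hcon⟩
  obtain ⟨z, hz⟩ := this
  have key : ∀ m' ∈ M, z ≡ (f m' : ℤ) [ZMOD (m' : ℤ)] → m' = m := by
    intro m' hm' hzm
    by_contra hne
    refine hz (f m', m') (Finset.mem_erase.2 ⟨?_, mem_congruences.2 ⟨hm', rfl⟩⟩) hzm
    exact fun heq => hne (congrArg Prod.snd heq)
  refine ⟨z, ?_, key⟩
  obtain ⟨c, hc, hzc⟩ := h3 z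
  obtain ⟨hcM, hcf⟩ := mem_congruences.1 hc
  rw [← hcf] at hzc
  have := key c.2 hcM hzc
  rwa [this] at hzc

theorem card_filter_snd {M : Finset ℕ} {C : Finset (ℕ × ℕ)} (hC : C ∈ coveringsWithModuli M)
    {P : ℕ → Prop} {R : ℕ × ℕ → Prop} [DecidablePred P] [DecidablePred R]
    (h : ∀ c ∈ C, R c ↔ P c.2) : (C.filter R).card = (M.filter P).card := by
  classical
  rw [← hC.2, Finset.filter_image, Finset.card_image_of_injOn, Finset.filter_congr h]
  intro c hc d hd h
  simp only [Finset.coe_filter, Set.mem_ofPred_eq] at hc hd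
  exact hC.1.2.1 c hc.1 d hd.1 h

theorem snd_mem {M : Finset ℕ} {C : Finset (ℕ × ℕ)} (hC : C ∈ coveringsWithModuli M)
    {c : ℕ × ℕ} (hc : c ∈ C) : c.2 ∈ M := hC.2 ▸ Finset.mem_image_of_mem _ hc

namespace IsSunFactorization

variable {r : ℕ} {p α : ℕ → ℕ}

theorem prod_eq (hL : IsSunFactorization r p α) :
    ∏ i ∈ Finset.Icc 1 r, p i ^ α i = chainModulus p α (r - 1) (α (r - 1)) * p r := by
  obtain ⟨k, rfl⟩ : ∃ k, r = k + 1 := ⟨r - 1, by have := hL.one_lt; omega⟩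
  have hk : 1 ≤ k := hL.one_le_pred
  rw [← Finset.Ico_succ_right_eq_Icc, Nat.succ_eq_succ, Finset.prod_Ico_succ_top (by omega),
    Finset.prod_Ico_succ_top hk, hL.exponent_last, pow_one]
  simp [chainModulus]

theorem chainModulus_pred_mul (hL : IsSunFactorization r p α) :
    chainModulus p α (r - 1) (α (r - 1) - 1) * p (r - 1) =
      chainModulus p α (r - 1) (α (r - 1)) := by
  rw [← chainModulus_succ, Nat.sub_add_cancel hL.one_le_exponent_pred]

theorem pow_dvd_iff (hL : IsSunFactorization r p α) {m : ℕ}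
    (hm : m ∣ chainModulus p α (r - 1) (α (r - 1)) * p r) :
    p (r - 1) ^ α (r - 1) ∣ m ↔ ¬ m ∣ chainModulus p α (r - 1) (α (r - 1) - 1) * p r := by
  have hb := hL.prime_pred
  constructor
  · intro h1 h2
    have h3 := h1.trans h2
    have hc : (p (r - 1) ^ α (r - 1)).Coprime (p r) := by
      refine Nat.Coprime.pow_left _ ?_
      rw [Nat.coprime_primes hb hL.prime_last]
      exact hL.pred_lt_last.ne
    have hc' : (p (r - 1) ^ α (r - 1)).Coprime (chainModulus p α (r - 1) 0) :=
      (Nat.Coprime.pow_right _ (hL.coprime_chainModulus le_rfl hL.one_le_pred (by omega))).symm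
    have h4 := hc.dvd_of_dvd_mul_right h3
    rw [chainModulus_eq_mul] at h4
    have h5 := hc'.dvd_of_dvd_mul_left h4
    have h6 := (Nat.pow_dvd_pow_iff_le_right hb.one_lt).1 h5
    have := hL.one_le_exponent_pred
    omega
  · intro h
    by_contra hcon
    apply h
    rw [chainModulus_eq_mul, mul_right_comm] at hm ⊢
    exact dvd_mul_pow_pred hb hm hL.one_le_exponent_pred hcon

theorem last_dvd_iff (hL : IsSunFactorization r p α) {m : ℕ}
    (hm : m ∣ chainModulus p α (r - 1) (α (r - 1)) * p r) :
    p r ∣ m ↔ ¬ m ∣ chainModulus p α (r - 1) (α (r - 1)) := by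
  constructor
  · intro h1 h2
    have := (hL.coprime_chainModulus_last (α (r - 1))).symm
    exact hL.prime_last.one_lt.ne' (Nat.Coprime.eq_one_of_dvd this (h1.trans h2))
  · intro h
    by_contra hcon
    exact h (((Nat.Prime.coprime_iff_not_dvd hL.prime_last).2 hcon).symm.dvd_of_dvd_mul_right hm)

theorem not_last_sq_dvd (hL : IsSunFactorization r p α) {m : ℕ}
    (hm : m ∣ chainModulus p α (r - 1) (α (r - 1)) * p r) : ¬ p r ^ 2 ∣ m := by
  intro h
  have h1 := h.trans hm
  rw [sq] at h1
  have h2 := Nat.dvd_of_mul_dvd_mul_right hL.prime_last.pos h1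
  have := (hL.coprime_chainModulus_last (α (r - 1))).symm
  exact hL.prime_last.one_lt.ne' (Nat.Coprime.eq_one_of_dvd this h2)

theorem not_pow_succ_dvd (hL : IsSunFactorization r p α) {m : ℕ}
    (hm : m ∣ chainModulus p α (r - 1) (α (r - 1))) :
    ¬ p (r - 1) ^ (α (r - 1) + 1) ∣ m := by
  intro h
  have hc : (p (r - 1) ^ (α (r - 1) + 1)).Coprime (chainModulus p α (r - 1) 0) :=
    (Nat.Coprime.pow_right _ (hL.coprime_chainModulus le_rfl hL.one_le_pred (by omega))).symm
  have h4 := h.trans hm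
  rw [chainModulus_eq_mul] at h4
  have h6 := (Nat.pow_dvd_pow_iff_le_right hL.prime_pred.one_lt).1 (hc.dvd_of_dvd_mul_left h4)
  omega

end IsSunFactorization

section Parts

variable {r : ℕ} {p α : ℕ → ℕ} {M : Finset ℕ} {C : Finset (ℕ × ℕ)}

theorem card_levelPart_pred (hL : IsSunFactorization r p α)
    (hM : ∀ m ∈ M, m ∣ chainModulus p α (r - 1) (α (r - 1)) * p r)
    (hC : C ∈ coveringsWithModuli M) :
    (levelPart r p C (r - 1) (α (r - 1))).card =
      (newMods M (chainModulus p α (r - 1) (α (r - 1) - 1)) (p (r - 1))).card := by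
  classical
  have hr := hL.one_lt
  have hIoc : Finset.Ioc (r - 1) r = {r} := by
    ext k
    simp only [Finset.mem_Ioc, Finset.mem_singleton]
    omega
  refine card_filter_snd hC fun c hcC => ?_
  have hm := snd_mem hC hcC
  generalize c.2 = m at hm
  have h1 := hL.pow_dvd_iff (hM m hm)
  have h2 := hL.last_dvd_iff (hM m hm)
  have h3 := hL.not_pow_succ_dvd (m := m)
  rw [hIoc, hL.chainModulus_pred_mul]
  simp only [Finset.mem_singleton, forall_eq]
  constructor
  · rintro ⟨⟨h4, -⟩, h6⟩
    exact ⟨by tauto, fun h => (h1.1 h4) (h.mul_right _)⟩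
  · rintro ⟨h4, h5⟩
    refine ⟨⟨h1.2 fun h => h5 ?_, h3 h4⟩, by tauto⟩
    have hc : (p r).Coprime m := (Nat.Prime.coprime_iff_not_dvd hL.prime_last).2 (by tauto)
    exact hc.symm.dvd_of_dvd_mul_right h

theorem card_partQ (hL : IsSunFactorization r p α)
    (hM : ∀ m ∈ M, m ∣ chainModulus p α (r - 1) (α (r - 1)) * p r)
    (hC : C ∈ coveringsWithModuli M) :
    (partQ r p α C).card =
      (newMods M (chainModulus p α (r - 1) (α (r - 1) - 1)) (p r)).card := by
  classical
  rw [partQ, levelPart, Finset.filter_filter]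
  refine card_filter_snd hC fun c hcC => ?_
  have hm := snd_mem hC hcC
  generalize c.2 = m at hm
  have h1 := hL.pow_dvd_iff (hM m hm)
  have h2 := hL.last_dvd_iff (hM m hm)
  have h3 := hL.not_last_sq_dvd (hM m hm)
  simp only [pow_one, Finset.Ioc_self, Finset.notMem_empty, false_imp_iff, implies_true, and_true]
  have h4 : m ∣ chainModulus p α (r - 1) (α (r - 1) - 1) →
      m ∣ chainModulus p α (r - 1) (α (r - 1)) := fun h => by
    rw [← hL.chainModulus_pred_mul]
    exact h.mul_right _
  constructor
  · rintro ⟨⟨h5, -⟩, h6⟩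
    exact ⟨by tauto, fun h => h2.1 h5 (h4 h)⟩
  · rintro ⟨h5, h6⟩
    refine ⟨⟨?_, h3⟩, by tauto⟩
    by_contra hcon
    exact h6 (((Nat.Prime.coprime_iff_not_dvd hL.prime_last).2 hcon).symm.dvd_of_dvd_mul_right h5)

theorem card_levelPart_last (hL : IsSunFactorization r p α)
    (hM : ∀ m ∈ M, m ∣ chainModulus p α (r - 1) (α (r - 1)) * p r)
    (hC : C ∈ coveringsWithModuli M) :
    (levelPart r p C r 1).card - (partQ r p α C).card =
      (mixedMods M (chainModulus p α (r - 1) (α (r - 1) - 1)) (p (r - 1)) (p r)).card := by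
  classical
  have h0 := Finset.card_filter_add_card_filter_not (s := levelPart r p C r 1)
    (fun c => ¬ p (r - 1) ^ α (r - 1) ∣ c.2)
  rw [← partQ] at h0
  rw [← h0, Nat.add_sub_cancel_left, levelPart, Finset.filter_filter]
  refine card_filter_snd hC fun c hcC => ?_
  have hm := snd_mem hC hcC
  generalize c.2 = m at hm
  have h1 := hL.pow_dvd_iff (hM m hm)
  have h2 := hL.last_dvd_iff (hM m hm)
  have h3 := hL.not_last_sq_dvd (hM m hm)
  simp only [pow_one, Finset.Ioc_self, Finset.notMem_empty, false_imp_iff, implies_true, and_true]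
  rw [hL.chainModulus_pred_mul]
  tauto

end Parts

theorem theorem2p5 (r : ℕ) (p α : ℕ → ℕ) (hL : IsSunFactorization r p α)
    (M : Finset ℕ) (hM : IsMinimalModuli M)
    (hlcm : M.lcm id = ∏ i ∈ Finset.Icc 1 r, p i ^ α i)
    (C : Finset (ℕ × ℕ)) (hC : C ∈ coveringsWithModuli M) :
    (levelPart r p C (r - 1) (α (r - 1))).card ≤ p (r - 1) ∧
    (partQ r p α C).card ≤ p r ∧
    ((coveringsWithModuli M).ncard : ℚ) =
      (((levelPart r p C r 1).card - (partQ r p α C).card)! : ℚ) /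
        (((p (r - 1) - (levelPart r p C (r - 1) (α (r - 1))).card)! : ℚ) *
          ((p r - (partQ r p α C).card)! : ℚ)) *
      ∏ i ∈ Finset.Icc 1 r, ((p i)! : ℚ) ^ α i := by
  have hr1 := hL.one_le_pred
  have hα := hL.one_le_exponent_pred
  have hdvd : ∀ m ∈ M, m ∣ chainModulus p α (r - 1) (α (r - 1)) * p r := by
    intro m hm
    rw [← hL.prod_eq, ← hlcm]
    exact Finset.dvd_lcm (f := id) hm
  have hM2 : ∀ m ∈ M, 2 ≤ m := by
    intro m hm
    rw [← hC.2] at hm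
    obtain ⟨c, hc, rfl⟩ := Finset.mem_image.1 hm
    exact (hC.1.1 c hc).1
  have h1M : 1 ∉ M := fun h => by simpa using hM2 1 h
  have hpriv : ∀ f ∈ coveringSystems M, ∀ m ∈ M, ∃ z : ℤ, z ≡ (f m : ℤ) [ZMOD (m : ℤ)] ∧
      ∀ m' ∈ M, z ≡ (f m' : ℤ) [ZMOD (m' : ℤ)] → m' = m := fun f hf =>
    exists_private_of_isMinimalCovering (hM.2 _ (congruences_mem hM2 hf))
  obtain ⟨f₀, hf₀, -⟩ := exists_congruences_eq hC
  have hfull : ∀ s t, 1 ≤ s → (s < r - 1 ∧ t < α s) ∨ (s = r - 1 ∧ t + 1 < α s) →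
      (newMods M (chainModulus p α s t) (p s)).card + 1 = p s := fun s t hs hst =>
    (hL.level_step hdvd hf₀.2 (hpriv f₀ hf₀) hs hst (hL.hasSingleHole_chain hdvd h1M hf₀.2
      (hpriv f₀ hf₀) hs (by omega))).1
  have hchain := hL.ncard_singleHoleSystems_chain h1M hfull hr1
    (t := α (r - 1) - 1) (Or.inr ⟨rfl, by omega⟩)
  have hlt := hL.card_newMods_lt M hr1 le_rfl (α (r - 1) - 1)
  obtain ⟨hQ, hcount⟩ := ncard_coveringSystems_grid hL.prime_pred hL.prime_last
    hL.pred_lt_last.ne (hL.chainModulus_pos hr1 (by omega) (α (r - 1) - 1))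
    (by rwa [hL.chainModulus_pred_mul]) hlt hpriv
    (fun f hf => hL.hasSingleHole_chain hdvd h1M hf.2 (hpriv f hf) hr1
      (Or.inr ⟨rfl, by omega⟩)) ⟨f₀, hf₀⟩
  have hprod : ∏ i ∈ Finset.Icc 1 r, ((p i)! : ℚ) ^ α i =
      ((∏ i ∈ Finset.Ico 1 (r - 1), ((p i)! : ℚ) ^ α i) * ((p (r - 1))! : ℚ) ^ (α (r - 1) - 1)) *
        (p (r - 1))! * (p r)! := by
    obtain ⟨k, rfl⟩ : ∃ k, r = k + 1 := ⟨r - 1, by omega⟩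
    rw [Nat.add_sub_cancel] at hr1 hα ⊢
    rw [← Finset.Ico_succ_right_eq_Icc, Nat.succ_eq_succ, Finset.prod_Ico_succ_top (by omega),
      Finset.prod_Ico_succ_top hr1, hL.exponent_last, pow_one, mul_assoc _ _ ((p k)! : ℚ),
      ← pow_succ, Nat.sub_add_cancel hα]
  rw [ncard_coveringsWithModuli hM2, hcount, hchain, card_levelPart_last hL hdvd hC,
    card_levelPart_pred hL hdvd hC, card_partQ hL hdvd hC, hprod]
  refine ⟨hlt.le, hQ, ?_⟩
  rw [← Nat.factorial_mul_descFactorial hlt.le, ← Nat.factorial_mul_descFactorial hQ]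
  have h1 := Nat.factorial_ne_zero (p (r - 1) -
    (newMods M (chainModulus p α (r - 1) (α (r - 1) - 1)) (p (r - 1))).card)
  have h2 := Nat.factorial_ne_zero (p r -
    (newMods M (chainModulus p α (r - 1) (α (r - 1) - 1)) (p r)).card)
  push_cast
  field_simp
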